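/- **Setting.** Let $\mathcal G=(\mathcal V,\mathcal E)$ be a finite directed multigraph without self-loops; the link $e$ goes from its tail $\sigma_e$ to its head $\tau_e$, and has a flow capacity $C_e\in(0,+\infty]$ and a buffer capacity $B_e\in(0,+\infty]$. Let $\mathcal D$ be the set of destinations, i.e. of nodes without outgoing links, let $\lambda_v\ge 0$ be the external inflow at $v\in\mathcal V$, with $\lambda_v=0$ for $v\in\mathcal D$, and let $\mathcal O=\{v:\lambda_v>0\}$ be the set of origins. Add a node $w$, an entry link $e_v=(w,v)$ for each $v\in\mathcal O$, and an exit link $e^d=(d,w)$ for each $d\in\mathcal D$. Assume that $\mathcal D\neq\emptyset$ and that this augmented network is strongly connected. A *cut* is a nonempty set $\mathcal U\subseteq\mathcal V\setminus\mathcal D$; put $\lambda_{\mathcal U}=\sum_{v\in\mathcal U}\lambda_v$ and $C_{\mathcal U}=\sum_{e:\,\sigma_e\in\mathcal U,\,\tau_e\notin\mathcal U}C_e$. Let $\mathcal R=\prod_{e\in\mathcal E}[0,B_e)$. **Policies.** For $i\in\mathcal E\cup\{e_v:v\in\mathcal O\}$ let $\mathcal E_i^+$ be the set of the links (exit links included)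 whose tail is the head of $i$, let $\mathcal E_i$ be the set of the links in $\mathcal E$ that lie in $\mathcal E_i^+$ or are equal to $i$, and let $$\mathcal R_i^\bullet=\Big\{x\in\prod_{k\in\mathcal E_i}[0,B_k]:\ x_k\ne B_k\text{ for some }k\in\mathcal E_i\Big\}.$$ A *distributed routing policy* is a family of continuous maps $f^i=(f_{i\to j})_{j\in\mathcal E_i^+}:\mathcal R_i^\bullet\to[0,\infty)^{\mathcal E_i^+}$ (infinite densities are treated in the topology of $[0,+\infty]$) that are locally Lipschitz on $\prod_{k\in\mathcal E_i}[0,B_k)$ and satisfy the following, with $f_i^{\rm out}=\sum_{j\in\mathcal E_i^+}f_{i\to j}$: * $f^{\rm out}_{e_v}\equiv\lambda_v$ for $v\in\mathcal O$, and $f^{\rm out}_e\le C_e$ for $e\in\mathcal E$; * for $e\in\mathcal E$ and $x\in\mathcal R^\bullet_e$: $x_e=0$ implies $f_e^{\rm out}(x)=0$, and $x_e=B_e$ implies $f^{\rm out}_e(x)=C_e$; if $\tau_e\in\mathcal D$ (so that $\mathcal R_e^\bullet=[0,B_e)$), then $f_e^{\rm out}(x)\to C_e$ as $x_e\uparrow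 B_e$; * for all $i$, all $k\in\mathcal E_i^+\cap\mathcal E$ and $x\in\mathcal R_i^\bullet$: $x_k=B_k$ implies $f_{i\to k}(x)=0$. The policy is *monotone* if, for every $i$ and almost every $x\in\prod_{k\in\mathcal E_i}[0,B_k)$, $$\text{(a)}\quad \frac{\partial f_{i\to j}}{\partial\rho_k}(x)\ge 0\quad\text{for } j\in\mathcal E_i^+,\ k\in\mathcal E_i\setminus\{j\};\qquad \text{(b)}\quad \frac{\partial f^{\rm out}_i}{\partial\rho_k}(x)\le 0\quad\text{for } k\in\mathcal E_i^+\cap\mathcal E.$$ It is *strongly monotone* if, moreover, on every segment in $\prod_{k\in\mathcal E_i}(0,B_k)$ that is parallel to the axis of the coordinate $k$, the inequalities (a) (for every $i$) and (b) (for every $i\in\mathcal E$) with respect to $\rho_k$ are strict at almost every point of the segment. **Dynamics.** Consider $$\dot\rho_e=\sum_i f_{i\to e}(\rho)-f_e^{\rm out}(\rho),\qquad e\in\mathcal E,$$ where the sum is over all $i$ with $e\in\mathcal E_i^+$, and each flow is evaluated at the densities of the links in $\mathcal E_i$. For $\rho^\circ\in\mathcal R$ let $\kappa(\rho^\circ)\in[0,+\infty]$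 be the supremum of the $T$ such that a solution with $\rho(0)=\rho^\circ$ and values in $\mathcal R$ exists on $[0,T)$. **Theorem.** Let $f$ be a monotone distributed routing policy. For every $\rho^\circ\in\mathcal R$ we have $\kappa(\rho^\circ)>0$, and there is a unique solution $\rho(t)\in\mathcal R$, $0\le t<\kappa(\rho^\circ)$, with $\rho(0)=\rho^\circ$. Moreover: (i) If $\max_{\mathcal U}(\lambda_{\mathcal U}-C_{\mathcal U})<0$, the maximum being over all cuts, then $\kappa(\rho^\circ)=+\infty$ for every $\rho^\circ\in\mathcal R$. If in addition $f$ is strongly monotone, then there is an equilibrium $\rho^*\in\mathcal R$ such that $\lim_{t\to\infty}\rho(t)=\rho^*$ for every $\rho^\circ\in\mathcal R$. (ii) If $\max_{\mathcal U}(\lambda_{\mathcal U}-C_{\mathcal U})>0$, or if $\max_{\mathcal U}(\lambda_{\mathcal U}-C_{\mathcal U})=0$ and $f$ is strongly monotone, then for every $\rho^\circ\in\mathcal R$ there is a cut $\mathcal S$ such that $$\lim_{t\uparrow\kappa(\rho^\circ)}\rho_e(t)=B_e\qquad\text{for every link } e \text{ with } \sigma_e\in\mathcal S.$$ -/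

import Mathlib

open Set Filter Topology MeasureTheory
open scoped NNReal ENNReal

/-- A directed multigraph without self-loops on the node type `V` and the link type `E`, with link
capacities in `(0, ∞]`, buffer capacities in `(0, ∞]`, and external inflows at the nodes. Inflows
enter only at nodes that have an outgoing link. -/
structure FlowNetwork (V E : Type*) where
  tail : E → V
  head : E → V
  head_ne_tail : ∀ e, head e ≠ tail e
  capacity : E → ℝ≥0∞
  capacity_pos : ∀ e, 0 < capacity e
  buffer : E → ℝ≥0∞
  buffer_pos : ∀ e, 0 < buffer e
  inflow : V → ℝ≥0
  inflow_eq_zero : ∀ v, (∀ e, tail e ≠ v) → inflow v = 0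

namespace FlowNetwork

variable {V E : Type*} [Fintype V] [DecidableEq V] [Fintype E] [DecidableEq E]

/-- The destination nodes: the nodes without outgoing links. -/
def dests (N : FlowNetwork V E) : Finset V :=
  Finset.univ.filter fun v => ∀ e, N.tail e ≠ v

open Classical in
/-- The origin nodes: the nodes with positive external inflow. -/
noncomputable def origins (N : FlowNetwork V E) : Finset V :=
  Finset.univ.filter fun v => 0 < N.inflow v

/-- The links of the augmented network; `none` is the external world. -/
inductive AugAdj (N : FlowNetwork V E) : Option V → Option V → Prop
  | link (e : E) : AugAdj N (some (N.tail e)) (some (N.head e))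
  | entry (v : V) (hv : v ∈ N.origins) : AugAdj N none (some v)
  | exit (v : V) (hv : v ∈ N.dests) : AugAdj N (some v) none

/-- There is a destination, and the augmented network is strongly connected. -/
def Connected (N : FlowNetwork V E) : Prop :=
  N.dests.Nonempty ∧ ∀ x y : Option V, Relation.ReflTransGen N.AugAdj x y

/-- The cuts: the nonempty sets of non-destination nodes. -/
def cuts (N : FlowNetwork V E) : Finset (Finset V) :=
  Finset.univ.filter fun U => U.Nonempty ∧ Disjoint U N.dests

/-- The capacity of a cut: the total capacity of the links that leave it. -/
noncomputable def cutCapacity (N : FlowNetwork V E) (U : Finset V) : ℝ≥0∞ :=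
  ∑ e with N.tail e ∈ U ∧ N.head e ∉ U, N.capacity e

/-- The aggregate external inflow of a cut. -/
noncomputable def cutInflow (N : FlowNetwork V E) (U : Finset V) : ℝ≥0 :=
  ∑ v ∈ U, N.inflow v

/-- The maximum over all cuts of external inflow minus capacity (`-∞` if the capacity is `∞`). -/
noncomputable def maxExcess (N : FlowNetwork V E) : EReal :=
  N.cuts.sup fun U => (((N.cutInflow U : ℝ≥0∞) : EReal) - (N.cutCapacity U : EReal))

/-- The links from which particles are routed: the links of the network, and one entry link for
each origin. -/
abbrev Source (N : FlowNetwork V E) : Type _ := E ⊕ N.origins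

/-- The links to which particles are routed: the links of the network, and one exit link for
each destination. -/
abbrev Target (N : FlowNetwork V E) : Type _ := E ⊕ N.dests

/-- The node at which a source link ends. -/
def sourceHead (N : FlowNetwork V E) : N.Source → V :=
  Sum.elim N.head Subtype.val

/-- The node at which a target link starts. -/
def targetTail (N : FlowNetwork V E) : N.Target → V :=
  Sum.elim N.tail Subtype.val

/-- The links whose densities are available for routing from the source `i`: the links downstream
of `i`, together with `i` itself when `i` is a link of the network. -/
def localLinks (N : FlowNetwork V E) (i : N.Source) : Finset E :=
  Finset.univ.filter fun k => N.tail k = N.sourceHead i ∨ i = Sum.inl k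

/-- A link of the network as one of its own local links. -/
def self (N : FlowNetwork V E) (e : E) : N.localLinks (Sum.inl e) :=
  ⟨e, by simp [localLinks]⟩

/-- The local densities, each at most the buffer capacity, at which not all of the local links are
at their buffer capacities. For a link `e` that ends in a destination this is `[0, B_e)`. -/
def localDomain (N : FlowNetwork V E) (i : N.Source) : Set (N.localLinks i → ℝ≥0∞) :=
  {x | (∀ k, x k ≤ N.buffer k) ∧ ∃ k, x k ≠ N.buffer k}

/-- The finite local densities strictly below the buffer capacities. -/
def localBox (N : FlowNetwork V E) (i : N.Source) : Set (N.localLinks i → ℝ) :=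
  {x | ∀ k, 0 ≤ x k ∧ ENNReal.ofReal (x k) < N.buffer k}

/-- The state space, the product of the intervals `[0, B_e)`. -/
def states (N : FlowNetwork V E) : Set (E → ℝ) :=
  {ρ | ∀ e, 0 ≤ ρ e ∧ ENNReal.ofReal (ρ e) < N.buffer e}

/-- A distributed routing policy: `flow i x j` is the flow from `i` to `j` at the local density
vector `x`. Only its values at `x ∈ N.localDomain i` are relevant. -/
structure RoutingPolicy (N : FlowNetwork V E) where
  flow : (i : N.Source) → (N.localLinks i → ℝ≥0∞) → N.Target → ℝ≥0
  /-- Particles move only to downstream links. -/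
  flow_eq_zero : ∀ i, ∀ x ∈ N.localDomain i, ∀ j,
    N.targetTail j ≠ N.sourceHead i → flow i x j = 0
  /-- The flows are continuous, also where some densities are at a buffer capacity, be it finite
  or infinite. -/
  continuousOn : ∀ i, ContinuousOn (flow i) (N.localDomain i)
  /-- The flows are locally Lipschitz where all densities are below the buffer capacities. -/
  locallyLipschitzOn : ∀ i,
    LocallyLipschitzOn (N.localBox i) fun x => flow i fun k => ENNReal.ofReal (x k)
  outflow_le : ∀ e, ∀ x ∈ N.localDomain (Sum.inl e),
    ((∑ j, flow (Sum.inl e) x j : ℝ≥0) : ℝ≥0∞) ≤ N.capacity e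
  outflow_origin : ∀ v : N.origins, ∀ x ∈ N.localDomain (Sum.inr v),
    ∑ j, flow (Sum.inr v) x j = N.inflow v
  outflow_of_empty : ∀ e, ∀ x ∈ N.localDomain (Sum.inl e), x (N.self e) = 0 →
    ∑ j, flow (Sum.inl e) x j = 0
  outflow_of_congested : ∀ e, ∀ x ∈ N.localDomain (Sum.inl e), x (N.self e) = N.buffer e →
    ((∑ j, flow (Sum.inl e) x j : ℝ≥0) : ℝ≥0∞) = N.capacity e
  /-- For a link that ends in a destination, the buffer capacity is outside of the domain, and the
  outflow tends to the capacity as the density tends to the buffer capacity. -/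
  outflow_tendsto : ∀ e, N.head e ∈ N.dests →
    Tendsto (fun x => ((∑ j, flow (Sum.inl e) x j : ℝ≥0) : ℝ≥0∞))
      (𝓝[N.localDomain (Sum.inl e)] fun k => N.buffer k) (𝓝 (N.capacity e))
  /-- There is no flow to a downstream link at its buffer capacity. -/
  flow_to_congested : ∀ i, ∀ x ∈ N.localDomain i, ∀ k : N.localLinks i,
    N.tail k = N.sourceHead i → x k = N.buffer k → flow i x (Sum.inl k) = 0

namespace RoutingPolicy

variable {N : FlowNetwork V E}

/-- The flow from `i` to `j` as a real function of finite local densities. -/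
noncomputable def realFlow (f : N.RoutingPolicy) (i : N.Source) (j : N.Target)
    (x : N.localLinks i → ℝ) : ℝ :=
  f.flow i (fun k => ENNReal.ofReal (x k)) j

/-- The total outflow from `i` as a real function of finite local densities. -/
noncomputable def realOutflow (f : N.RoutingPolicy) (i : N.Source)
    (x : N.localLinks i → ℝ) : ℝ :=
  ∑ j, f.realFlow i j x

/-- The partial derivative of `g` with respect to the coordinate `k` at `x`. -/
noncomputable def partialDeriv {ι : Type*} [DecidableEq ι] (g : (ι → ℝ) → ℝ) (k : ι)
    (x : ι → ℝ) : ℝ :=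
  deriv (fun s => g (Function.update x k s)) (x k)

/-- Monotonicity: almost everywhere, the flow to `j` does not decrease with the density of any
other local link, and the outflow does not increase with the density of any downstream link. -/
def IsMonotone (f : N.RoutingPolicy) : Prop :=
  ∀ i, ∀ᵐ x : N.localLinks i → ℝ, x ∈ N.localBox i →
    (∀ j, N.targetTail j = N.sourceHead i → ∀ k : N.localLinks i, j ≠ Sum.inl k.1 →
      0 ≤ partialDeriv (f.realFlow i j) k x) ∧
    (∀ k : N.localLinks i, N.tail k = N.sourceHead i →
      partialDeriv (f.realOutflow i) k x ≤ 0)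

/-- Strong monotonicity: the inequalities are strict almost everywhere along every segment parallel
to a coordinate axis in the interior of the domain. The outflow at an origin is constant, so
the second inequality can be strict only for the links of the network. -/
def IsStronglyMonotone (f : N.RoutingPolicy) : Prop :=
  f.IsMonotone ∧
  ∀ i, ∀ x ∈ N.localBox i, (∀ k, 0 < x k) → ∀ k : N.localLinks i,
    ∀ᵐ s : ℝ, 0 < s → ENNReal.ofReal s < N.buffer k →
      (∀ j, N.targetTail j = N.sourceHead i → j ≠ Sum.inl k.1 →
        0 < partialDeriv (f.realFlow i j) k (Function.update x k s)) ∧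
      (N.tail k = N.sourceHead i → i.isLeft →
        partialDeriv (f.realOutflow i) k (Function.update x k s) < 0)

/-- The total inflow of the link `e` at the density vector `ρ`. -/
noncomputable def inflowAt (f : N.RoutingPolicy) (ρ : E → ℝ) (e : E) : ℝ :=
  ∑ i, f.realFlow i (Sum.inl e) fun k => ρ k

/-- The total outflow of the link `e` at the density vector `ρ`. -/
noncomputable def outflowAt (f : N.RoutingPolicy) (ρ : E → ℝ) (e : E) : ℝ :=
  f.realOutflow (Sum.inl e) fun k => ρ k

/-- Equilibrium densities. -/
def IsEquilibrium (f : N.RoutingPolicy) (ρ : E → ℝ) : Prop :=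
  ρ ∈ N.states ∧ ∀ e, f.inflowAt ρ e = f.outflowAt ρ e

end RoutingPolicy

/-- The time interval `[0, T)`. -/
def timeInterval (T : ℝ≥0∞) : Set ℝ := {t | 0 ≤ t ∧ ENNReal.ofReal t < T}

namespace RoutingPolicy

variable {N : FlowNetwork V E}

/-- `ρ` is a solution of the dynamical flow network on `[0, T)` with initial density `ρ₀` that
stays in the state space. -/
def IsSolution (f : N.RoutingPolicy) (ρ₀ : E → ℝ) (T : ℝ≥0∞) (ρ : ℝ → E → ℝ) : Prop :=
  ρ 0 = ρ₀ ∧ ∀ t ∈ timeInterval T, ρ t ∈ N.states ∧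
    ∀ e, HasDerivWithinAt (fun s => ρ s e) (f.inflowAt (ρ t) e - f.outflowAt (ρ t) e)
      (timeInterval T) t

/-- The time `κ(ρ₀)` up to which the solution with initial density `ρ₀` exists and stays in the
state space. -/
noncomputable def exitTime (f : N.RoutingPolicy) (ρ₀ : E → ℝ) : ℝ≥0∞ :=
  sSup {T | ∃ ρ, f.IsSolution ρ₀ T ρ}

end RoutingPolicy

end FlowNetwork

/-!
The dynamics `ρ' = drift ρ` of a monotone policy are cooperative: `IsMonotone.drift_le` says that
the rate of change of the density of a link does not decrease with the densities of the other
links. The hypothesis concerns partial derivatives almost everywhere; Fubini's theorem and the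
fundamental theorem of calculus for absolutely continuous functions turn it into monotonicity
(`le_update_of_ae_partialDeriv_nonneg`). Cooperativity gives a comparison principle
(`IsSolution.le`), which contains uniqueness. Existence up to the exit time is the Picard-Lindelöf
theorem together with continuation.

The link between the dynamics and the cuts is `IsSolution.exists_cut`. Suppose that a solution
converges, at the end of its time interval, to a point at which the set `J` of congested links is
nonempty, and let `S` be the set of the nodes, other than destinations, all of whose outgoing
links are in `J`. A link that is not in `J`, or that ends outside of `S`, sends in the limit
nothing to links in `J`, while the links in `J` that end outside of `S` operate at capacity. Hence
the total density of `J` would decrease near the end if the inflow of `S` were smaller than its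
capacity. So `S` is a cut whose inflow is at least its capacity; it is nonempty since capacities
are positive. This applies at every finite exit time, because the inflows of links are bounded, so
that all densities have limits there. It also applies to the solution that starts with empty links
if that solution is global: it is nondecreasing in time, so it converges in the compactified state
space, either to such a point or to an equilibrium.

If every cut has excess capacity, it follows that all solutions are global and that there is an
equilibrium. If some cut is overloaded, flow conservation excludes an equilibrium. Under strong
monotonicity this includes the critical case, since equilibria are strictly positive
(`IsStronglyMonotone.equilibrium_pos`) and all outflows are then below capacity. In the overloaded
case the solution from empty links therefore congests a cut, or exit times are finite, and other
solutions lie above the solution from empty links.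

For global convergence to the equilibrium `p`, a solution is squeezed between the solution from
empty links and the solution `z` that starts from the supremum of `p` and its initial density.
Since `z ≥ p`, the total density of `z` is nonincreasing, and a one-sided form of Barbalat's lemma
(`eventually_lt_two_mul`) gives the convergence of the links that end in destinations. Convergence
then propagates upstream, because a surplus of density on a link would strictly increase the
inflow of each link downstream of it (`IsSolution.tendsto_of_equilibrium_le`).
-/

set_option linter.unusedSectionVars false

/-! ### Functions on boxes with signed partial derivatives -/

/-- The product of the intervals `[0, β k)`. Both `FlowNetwork.states` and `FlowNetwork.localBox`
are definitionally of this form. -/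
def densityBox {ι : Type*} (β : ι → ℝ≥0∞) : Set (ι → ℝ) :=
  {x | ∀ k, 0 ≤ x k ∧ ENNReal.ofReal (x k) < β k}

section Box

variable {ι : Type*} {β : ι → ℝ≥0∞}

theorem mem_densityBox_of_le {x y : ι → ℝ} (hy : y ∈ densityBox β) (h0 : 0 ≤ x) (hxy : x ≤ y) :
    x ∈ densityBox β := fun k =>
  ⟨h0 k, (ENNReal.ofReal_le_ofReal (hxy k)).trans_lt (hy k).2⟩

theorem sup_mem_densityBox {x y : ι → ℝ} (hx : x ∈ densityBox β) (hy : y ∈ densityBox β) :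
    x ⊔ y ∈ densityBox β := fun k => by
  rcases le_total (x k) (y k) with h | h
  · simpa [h] using hy k
  · simpa [h] using hx k

theorem update_mem_densityBox [DecidableEq ι] {x : ι → ℝ} (hx : x ∈ densityBox β) {k : ι} {s : ℝ}
    (h0 : 0 ≤ s) (hs : ENNReal.ofReal s < β k) : Function.update x k s ∈ densityBox β := by
  intro j
  by_cases h : j = k
  · subst h; simpa using ⟨h0, hs⟩
  · simpa [h] using hx j

theorem subset_closure_interior_densityBox :
    densityBox β ⊆ closure (univ.pi fun k => Ioi 0 ∩ {s : ℝ | ENNReal.ofReal s < β k}) := by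
  intro x hx
  rw [closure_pi_set]
  intro k _
  have ho : IsOpen {s : ℝ | ENNReal.ofReal s < β k} :=
    isOpen_lt ENNReal.continuous_ofReal continuous_const
  exact ho.closure_inter ⟨by rw [closure_Ioi]; exact (hx k).1, (hx k).2⟩

variable [Fintype ι]

theorem exists_lipschitzOnWith_Icc {g : (ι → ℝ) → ℝ} (hg : LocallyLipschitzOn (densityBox β) g)
    {b : ι → ℝ} (hb : b ∈ densityBox β) : ∃ K, LipschitzOnWith K g (Icc 0 b) :=
  (hg.mono fun _ hx => mem_densityBox_of_le hb hx.1 hx.2).exists_lipschitzOnWith_of_compact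
    isCompact_Icc

variable [DecidableEq ι]

theorem absolutelyContinuousOnInterval_update {g : (ι → ℝ) → ℝ}
    (hg : LocallyLipschitzOn (densityBox β) g) {x : ι → ℝ} (hx : x ∈ densityBox β) {k : ι}
    {a b : ℝ} (ha : 0 ≤ a) (hab : a ≤ b) (hb : ENNReal.ofReal b < β k) :
    AbsolutelyContinuousOnInterval (fun r => g (Function.update x k r)) a b := by
  obtain ⟨K, hK⟩ := exists_lipschitzOnWith_Icc hg (update_mem_densityBox hx (ha.trans hab) hb)
  apply LipschitzOnWith.absolutelyContinuousOnInterval (K := K)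
  rw [uIcc_of_le hab]
  have hmem : ∀ r ∈ Icc a b, Function.update x k r ∈ Icc 0 (Function.update x k b) := by
    intro r hr
    constructor <;> intro j <;> by_cases h : j = k
    · subst h; simpa using ha.trans hr.1
    · simpa [h] using (hx j).1
    · subst h; simpa using hr.2
    · simp [h]
  refine LipschitzOnWith.of_dist_le_mul fun r hr r' hr' => ?_
  refine (hK.dist_le_mul _ (hmem r hr) _ (hmem r' hr')).trans ?_
  gcongr
  rw [dist_pi_le_iff dist_nonneg]
  intro j
  by_cases h : j = k
  · subst h; simp
  · simp [h]

omit [Fintype ι] in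
open FlowNetwork.RoutingPolicy in
theorem partialDeriv_update (g : (ι → ℝ) → ℝ) (k : ι) (x : ι → ℝ) (s : ℝ) :
    partialDeriv g k (Function.update x k s) = deriv (fun r => g (Function.update x k r)) s := by
  simp [partialDeriv]

open FlowNetwork.RoutingPolicy in
/-- A locally Lipschitz function is nondecreasing in a coordinate if the partial derivative is
nonnegative almost everywhere: by Fubini's theorem this holds along almost every line, and the
remaining lines are limits of these. -/
theorem le_update_of_ae_partialDeriv_nonneg {g : (ι → ℝ) → ℝ}
    (hg : LocallyLipschitzOn (densityBox β) g) {k : ι}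
    (h : ∀ᵐ x : ι → ℝ, x ∈ densityBox β → 0 ≤ partialDeriv g k x)
    {x : ι → ℝ} (hx : x ∈ densityBox β) {s : ℝ} (hxs : x k ≤ s) (hs : ENNReal.ofReal s < β k) :
    g x ≤ g (Function.update x k s) := by
  obtain ⟨t, ht, htm, hts⟩ := h.exists_measurable_mem
  have hae : ∀ᵐ y : ι → ℝ, ∀ᵐ r : ℝ, y + LinearMap.single ℝ (fun _ : ι => ℝ) k r ∈ t :=
    (ae_ae_add_linearMap_mem_iff (LinearMap.single ℝ (fun _ : ι => ℝ) k) volume volume htm).2 ht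
  set A := {y : ι → ℝ | ∀ᵐ r : ℝ, y + LinearMap.single ℝ (fun _ : ι => ℝ) k r ∈ t}
  have hA : Dense A := Measure.dense_of_ae hae
  set I : Set (ι → ℝ) := univ.pi fun k => Ioi 0 ∩ {s : ℝ | ENNReal.ofReal s < β k}
  have hI : IsOpen I := isOpen_set_pi finite_univ fun k _ =>
    isOpen_Ioi.inter (isOpen_lt ENNReal.continuous_ofReal continuous_const)
  have hIB : I ⊆ densityBox β := fun y hy j => ⟨(hy j trivial).1.le, (hy j trivial).2⟩
  have hcl : x ∈ closure (I ∩ A) := by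
    have := hA.open_subset_closure_inter hI
    exact closure_minimal this isClosed_closure (subset_closure_interior_densityBox hx)
  have hgood : ∀ y ∈ I ∩ A, g (Function.update y k (x k)) ≤ g (Function.update y k s) := by
    rintro y ⟨hyI, hyA⟩
    have hyB := hIB hyI
    have hac := absolutelyContinuousOnInterval_update hg hyB (k := k) (hx k).1 hxs hs
    have hae' : ∀ᵐ r : ℝ, Function.update y k r ∈ t := by
      have := (measurePreserving_sub_right volume (y k)).quasiMeasurePreserving.ae hyA
      filter_upwards [this] with r hr
      convert hr using 1
      ext j
      by_cases hj : j = k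
      · subst hj; simp
      · simp [hj]
    have hnn : 0 ≤ ∫ r in (x k)..s, deriv (fun r => g (Function.update y k r)) r := by
      apply intervalIntegral.integral_nonneg_of_ae_restrict hxs
      filter_upwards [ae_restrict_of_ae hae', ae_restrict_mem measurableSet_Icc] with r hr hrm
      have h1 : Function.update y k r ∈ densityBox β :=
        update_mem_densityBox hyB ((hx k).1.trans hrm.1)
          ((ENNReal.ofReal_le_ofReal hrm.2).trans_lt hs)
      simpa only [partialDeriv_update, Pi.zero_apply] using hts _ hr h1
    rw [hac.integral_deriv_eq_sub] at hnn
    linarith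
  have hcont : ∀ r, 0 ≤ r → ENNReal.ofReal r < β k →
      Tendsto (fun y => g (Function.update y k r)) (𝓝[I ∩ A] x)
        (𝓝 (g (Function.update x k r))) := by
    intro r h0 hr
    have hc := hg.continuousOn (Function.update x k r) (update_mem_densityBox hx h0 hr)
    refine Tendsto.comp hc (tendsto_nhdsWithin_iff.2 ⟨?_, ?_⟩)
    · exact ((continuous_id.update k continuous_const).tendsto x).mono_left nhdsWithin_le_nhds
    · filter_upwards [self_mem_nhdsWithin] with y hy using update_mem_densityBox (hIB hy.1) h0 hr
  have : (𝓝[I ∩ A] x).NeBot := mem_closure_iff_nhdsWithin_neBot.1 hcl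
  have := le_of_tendsto_of_tendsto (hcont (x k) (hx k).1 (hx k).2)
    (hcont s ((hx k).1.trans hxs) hs) (by
      filter_upwards [self_mem_nhdsWithin] with y hy using hgood y hy)
  simpa using this

open FlowNetwork.RoutingPolicy in
theorem lt_update_of_ae_partialDeriv_pos {g : (ι → ℝ) → ℝ}
    (hg : LocallyLipschitzOn (densityBox β) g) {k : ι} {x : ι → ℝ} (hx : x ∈ densityBox β)
    (h : ∀ᵐ s : ℝ, 0 < s → ENNReal.ofReal s < β k →
      0 < partialDeriv g k (Function.update x k s))
    {s : ℝ} (hxs : x k < s) (hs : ENNReal.ofReal s < β k) :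
    g x < g (Function.update x k s) := by
  have hac := absolutelyContinuousOnInterval_update hg hx (k := k) (hx k).1 hxs.le hs
  have hpos : 0 < ∫ r in (x k)..s, deriv (fun r => g (Function.update x k r)) r := by
    have hae : ∀ᵐ r : ℝ, r ∈ Ioc (x k) s → 0 < deriv (fun r => g (Function.update x k r)) r := by
      filter_upwards [h] with r hr hrm
      rw [← partialDeriv_update]
      exact hr ((hx k).1.trans_lt hrm.1) ((ENNReal.ofReal_le_ofReal hrm.2).trans_lt hs)
    rw [intervalIntegral.integral_pos_iff_support_of_nonneg_ae' _ hac.intervalIntegrable_deriv]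
    · refine ⟨hxs, lt_of_lt_of_le (b := volume (Ioc (x k) s)) (by simpa using hxs)
        (measure_mono_ae ?_)⟩
      filter_upwards [hae] with r hr hrm using ⟨(hr hrm).ne', hrm⟩
    · rw [uIoc_of_le hxs.le]
      filter_upwards [ae_restrict_of_ae hae, ae_restrict_mem measurableSet_Ioc] with r hr hrm
        using (hr hrm).le
  rw [hac.integral_deriv_eq_sub] at hpos
  simpa using hpos

/-- Monotonicity in each coordinate of a set `A` gives monotonicity in the coordinates of `A`
jointly. -/
theorem le_of_forall_le_update {A : Set ι} {g : (ι → ℝ) → ℝ}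
    (h : ∀ k ∈ A, ∀ x ∈ densityBox β, ∀ s, x k ≤ s → ENNReal.ofReal s < β k →
      g x ≤ g (Function.update x k s))
    {x y : ι → ℝ} (hx : x ∈ densityBox β) (hy : y ∈ densityBox β) (hxy : x ≤ y)
    (hA : ∀ k ∉ A, x k = y k) : g x ≤ g y := by
  have key : ∀ T : Finset ι, g x ≤ g (T.piecewise y x) := by
    intro T
    induction T using Finset.induction_on with
    | empty => simp
    | insert k T hk ih =>
      rw [Finset.piecewise_insert]
      by_cases hkA : k ∈ A
      · refine ih.trans (h k hkA _ ?_ _ ?_ (hy k).2)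
        · intro j
          by_cases hj : j ∈ T
          · simpa [hj] using hy j
          · simpa [hj] using hx j
        · simpa [hk] using hxy k
      · rw [← hA k hkA]
        convert ih using 2
        simp [hk]
  simpa using key Finset.univ

end Box

/-! ### Monotonicity and regularity of the flows -/

theorem LocallyLipschitzOn.comp_lipschitzWith {X Y Z : Type*} [PseudoEMetricSpace X]
    [PseudoEMetricSpace Y] [PseudoEMetricSpace Z] {g : Y → Z} {r : X → Y} {s : Set X} {t : Set Y}
    {C : ℝ≥0} (hg : LocallyLipschitzOn t g) (hr : LipschitzWith C r) (h : MapsTo r s t) :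
    LocallyLipschitzOn s fun x => g (r x) := by
  intro x hx
  obtain ⟨K, u, hu, hK⟩ := hg (h hx)
  refine ⟨K * C, r ⁻¹' u, (hr.continuous.continuousWithinAt.tendsto_nhdsWithin h) hu, ?_⟩
  exact hK.comp (hr.lipschitzOnWith (s := r ⁻¹' u)) (fun _ hy => hy)

theorem LocallyLipschitzOn.finset_sum {X κ : Type*} [PseudoEMetricSpace X] {s : Set X}
    {g : κ → X → ℝ} (T : Finset κ) (h : ∀ j ∈ T, LocallyLipschitzOn s (g j)) :
    LocallyLipschitzOn s fun x => ∑ j ∈ T, g j x := by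
  classical
  induction T using Finset.induction_on with
  | empty =>
    intro x _
    exact ⟨0, univ, univ_mem, by simp [LipschitzOnWith]⟩
  | insert j T hj ih =>
    simp only [Finset.sum_insert hj]
    exact (h j (by simp)).add (ih fun k hk => h k (by simp [hk]))

namespace FlowNetwork

variable {V E : Type*} [Fintype V] [DecidableEq V] [Fintype E] [DecidableEq E]
  {N : FlowNetwork V E}

theorem not_mem_dests_tail (e : E) : N.tail e ∉ N.dests := by
  simp only [dests, Finset.mem_filter, Finset.mem_univ, true_and, not_forall, not_not]
  exact ⟨e, rfl⟩

theorem exists_tail_eq {v : V} (hv : v ∉ N.dests) : ∃ e, N.tail e = v := by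
  simpa [dests] using hv

theorem not_mem_dests_of_mem_origins {v : V} (hv : v ∈ N.origins) : v ∉ N.dests := by
  intro hd
  have h1 : 0 < N.inflow v := by simpa [origins] using hv
  exact h1.ne' (N.inflow_eq_zero v (by simpa [dests] using hd))

theorem mem_localLinks {i : N.Source} {k : E} :
    k ∈ N.localLinks i ↔ N.tail k = N.sourceHead i ∨ i = Sum.inl k := by
  simp [localLinks]

instance localLinks_nonempty (i : N.Source) : Nonempty (N.localLinks i) := by
  rcases i with e | v
  · exact ⟨N.self e⟩
  · obtain ⟨e, he⟩ := exists_tail_eq (not_mem_dests_of_mem_origins v.2)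
    exact ⟨⟨e, mem_localLinks.2 (Or.inl he)⟩⟩

theorem ofReal_mem_localDomain {i : N.Source} {x : N.localLinks i → ℝ} (hx : x ∈ N.localBox i) :
    (fun k => ENNReal.ofReal (x k)) ∈ N.localDomain i :=
  ⟨fun k => (hx k).2.le, (Classical.arbitrary _), (hx _).2.ne⟩

/-- The restriction of a density vector to the local links of `i`. -/
def localDensity (i : N.Source) (ρ : E → ℝ) : N.localLinks i → ℝ := fun k => ρ k

theorem localDensity_mem {i : N.Source} {ρ : E → ℝ} (hρ : ρ ∈ N.states) :
    localDensity i ρ ∈ N.localBox i := fun k => hρ k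

theorem lipschitzWith_localDensity (i : N.Source) :
    LipschitzWith 1 (localDensity (N := N) i) := by
  refine LipschitzWith.of_dist_le_mul fun x y => ?_
  rw [NNReal.coe_one, one_mul, dist_pi_le_iff dist_nonneg]
  exact fun k => dist_le_pi_dist x y k

namespace RoutingPolicy

variable {f : N.RoutingPolicy}

theorem realFlow_nonneg (i : N.Source) (j : N.Target) (x : N.localLinks i → ℝ) :
    0 ≤ f.realFlow i j x := NNReal.coe_nonneg _

theorem realFlow_eq_zero {i : N.Source} {j : N.Target} (h : N.targetTail j ≠ N.sourceHead i)
    {x : N.localLinks i → ℝ} (hx : x ∈ N.localBox i) : f.realFlow i j x = 0 := by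
  simp [realFlow, f.flow_eq_zero i _ (ofReal_mem_localDomain hx) j h]

theorem realOutflow_eq_coe (i : N.Source) (x : N.localLinks i → ℝ) :
    f.realOutflow i x =
      ((∑ j, f.flow i (fun k => ENNReal.ofReal (x k)) j : ℝ≥0) : ℝ) := by
  simp [realOutflow, realFlow]

theorem realOutflow_nonneg (i : N.Source) (x : N.localLinks i → ℝ) :
    0 ≤ f.realOutflow i x := Finset.sum_nonneg fun j _ => realFlow_nonneg i j x

theorem realFlow_le_realOutflow (i : N.Source) (j : N.Target) (x : N.localLinks i → ℝ) :
    f.realFlow i j x ≤ f.realOutflow i x :=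
  Finset.single_le_sum (f := fun j => f.realFlow i j x) (fun j _ => realFlow_nonneg i j x)
    (Finset.mem_univ j)

theorem locallyLipschitzOn_realFlow (i : N.Source) (j : N.Target) :
    LocallyLipschitzOn (N.localBox i) (f.realFlow i j) := by
  intro x hx
  obtain ⟨K, t, ht, hK⟩ := f.locallyLipschitzOn i hx
  refine ⟨K, t, ht, LipschitzOnWith.of_dist_le_mul fun y hy z hz => ?_⟩
  refine le_trans ?_ (hK.dist_le_mul y hy z hz)
  exact dist_le_pi_dist (f.flow i fun k => ENNReal.ofReal (y k))
    (f.flow i fun k => ENNReal.ofReal (z k)) j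

theorem locallyLipschitzOn_realOutflow (i : N.Source) :
    LocallyLipschitzOn (N.localBox i) (f.realOutflow i) :=
  LocallyLipschitzOn.finset_sum _ fun j _ => locallyLipschitzOn_realFlow i j

theorem IsMonotone.realFlow_le (hf : f.IsMonotone) {i : N.Source} {j : N.Target}
    {x y : N.localLinks i → ℝ} (hx : x ∈ N.localBox i) (hy : y ∈ N.localBox i) (hxy : x ≤ y)
    (h : ∀ k : N.localLinks i, j = Sum.inl k.1 → x k = y k) :
    f.realFlow i j x ≤ f.realFlow i j y := by
  by_cases hj : N.targetTail j = N.sourceHead i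
  · refine le_of_forall_le_update (β := fun k : N.localLinks i => N.buffer k)
      (A := {k | j ≠ Sum.inl k.1}) (fun k hk z hz s hs hsB => ?_) hx hy hxy
      (fun k hk => h k (by simpa using hk))
    refine le_update_of_ae_partialDeriv_nonneg (locallyLipschitzOn_realFlow i j) ?_ hz hs hsB
    filter_upwards [hf i] with w hw hwB using (hw hwB).1 j hj k hk
  · rw [realFlow_eq_zero hj hx, realFlow_eq_zero hj hy]

theorem IsMonotone.realOutflow_le (hf : f.IsMonotone) {i : N.Source}
    {x y : N.localLinks i → ℝ} (hx : x ∈ N.localBox i) (hy : y ∈ N.localBox i) (hxy : x ≤ y)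
    (h : ∀ k : N.localLinks i, N.tail k ≠ N.sourceHead i → x k = y k) :
    f.realOutflow i y ≤ f.realOutflow i x := by
  have := le_of_forall_le_update (β := fun k : N.localLinks i => N.buffer k)
      (A := {k | N.tail k = N.sourceHead i}) (g := fun x => -f.realOutflow i x)
      (fun k hk z hz s hs hsB => ?_) hx hy hxy (fun k hk => h k (by simpa using hk))
  · simpa using this
  refine le_update_of_ae_partialDeriv_nonneg (β := fun k : N.localLinks i => N.buffer k)
    (g := fun x => -f.realOutflow i x)
    (locallyLipschitzOn_realOutflow i).neg ?_ hz hs hsB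
  filter_upwards [hf i] with w hw hwB
  have := (hw hwB).2 k hk
  simp only [partialDeriv, deriv.fun_neg] at this ⊢
  linarith

theorem IsStronglyMonotone.realFlow_lt (hf : f.IsStronglyMonotone) {i : N.Source} {j : N.Target}
    (hj : N.targetTail j = N.sourceHead i) {x : N.localLinks i → ℝ} (hx : x ∈ N.localBox i)
    (hpos : ∀ k, 0 < x k) {k : N.localLinks i} (hk : j ≠ Sum.inl k.1) {s : ℝ} (hs : x k < s)
    (hsB : ENNReal.ofReal s < N.buffer k) :
    f.realFlow i j x < f.realFlow i j (Function.update x k s) := by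
  refine lt_update_of_ae_partialDeriv_pos (β := fun k : N.localLinks i => N.buffer k)
    (locallyLipschitzOn_realFlow i j) hx ?_ hs hsB
  filter_upwards [hf.2 i x hx hpos k] with r hr h0 hrB using (hr h0 hrB).1 j hj hk

/-! ### The vector field -/

theorem inflowAt_eq (ρ : E → ℝ) (e : E) :
    f.inflowAt ρ e = ∑ i, f.realFlow i (Sum.inl e) (localDensity i ρ) := rfl

theorem outflowAt_eq (ρ : E → ℝ) (e : E) :
    f.outflowAt ρ e = f.realOutflow (Sum.inl e) (localDensity (Sum.inl e) ρ) := rfl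

/-- The vector field of the dynamics. -/
noncomputable def drift (f : N.RoutingPolicy) (ρ : E → ℝ) (e : E) : ℝ :=
  f.inflowAt ρ e - f.outflowAt ρ e

theorem locallyLipschitzOn_outflowAt (e : E) :
    LocallyLipschitzOn N.states fun ρ => f.outflowAt ρ e :=
  (locallyLipschitzOn_realOutflow (Sum.inl e)).comp_lipschitzWith
    (lipschitzWith_localDensity _) fun _ hρ => localDensity_mem hρ

theorem locallyLipschitzOn_drift (e : E) :
    LocallyLipschitzOn N.states fun ρ => f.drift ρ e := by
  refine LocallyLipschitzOn.sub ?_ (locallyLipschitzOn_outflowAt e)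
  exact LocallyLipschitzOn.finset_sum _ fun i _ =>
    (locallyLipschitzOn_realFlow i (Sum.inl e)).comp_lipschitzWith
      (lipschitzWith_localDensity _) fun _ hρ => localDensity_mem hρ

theorem continuousOn_drift : ContinuousOn f.drift N.states :=
  continuousOn_pi.2 fun e => (locallyLipschitzOn_drift e).continuousOn

theorem exists_lipschitzOnWith_drift (f : N.RoutingPolicy) {b : E → ℝ} (hb : b ∈ N.states) :
    ∃ K : ℝ≥0, ∀ e, LipschitzOnWith K (fun ρ => f.drift ρ e) (Icc 0 b) := by
  choose K hK using fun e => exists_lipschitzOnWith_Icc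
    (locallyLipschitzOn_drift (f := f) e) hb
  exact ⟨∑ e, K e, fun e => (hK e).weaken
    (Finset.single_le_sum (f := K) (fun _ _ => zero_le) (Finset.mem_univ e))⟩

theorem IsMonotone.outflowAt_le (hf : f.IsMonotone) {ρ σ : E → ℝ} (hρ : ρ ∈ N.states)
    (hσ : σ ∈ N.states) (h : ρ ≤ σ) {e : E} (he : ρ e = σ e) :
    f.outflowAt σ e ≤ f.outflowAt ρ e := by
  refine hf.realOutflow_le (i := Sum.inl e) (localDensity_mem hρ) (localDensity_mem hσ)
    (fun k => h k) fun k hk => ?_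
  rcases mem_localLinks.1 k.2 with h1 | h1
  · exact absurd h1 hk
  · have hek : e = k := Sum.inl.inj h1
    exact hek ▸ he

theorem IsMonotone.realFlow_localDensity_le (hf : f.IsMonotone) {ρ σ : E → ℝ} (hρ : ρ ∈ N.states)
    (hσ : σ ∈ N.states) (h : ρ ≤ σ) {e : E} (he : ρ e = σ e) (i : N.Source) :
    f.realFlow i (Sum.inl e) (localDensity i ρ) ≤ f.realFlow i (Sum.inl e) (localDensity i σ) := by
  refine hf.realFlow_le (localDensity_mem hρ) (localDensity_mem hσ) (fun k => h k) fun k hk => ?_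
  have hek : e = k := Sum.inl.inj hk
  change ρ k = σ k
  exact hek ▸ he

/-- The vector field of a monotone policy is quasimonotone: the dynamics are cooperative. -/
theorem IsMonotone.drift_le (hf : f.IsMonotone) {ρ σ : E → ℝ} (hρ : ρ ∈ N.states)
    (hσ : σ ∈ N.states) (h : ρ ≤ σ) {e : E} (he : ρ e = σ e) : f.drift ρ e ≤ f.drift σ e :=
  sub_le_sub (Finset.sum_le_sum fun i _ => hf.realFlow_localDensity_le hρ hσ h he i)
    (hf.outflowAt_le hρ hσ h he)

theorem inflowAt_nonneg (ρ : E → ℝ) (e : E) : 0 ≤ f.inflowAt ρ e :=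
  Finset.sum_nonneg fun i _ => realFlow_nonneg i _ _

theorem outflowAt_nonneg (ρ : E → ℝ) (e : E) : 0 ≤ f.outflowAt ρ e := realOutflow_nonneg _ _

theorem outflowAt_of_eq_zero {ρ : E → ℝ} (hρ : ρ ∈ N.states) {e : E} (he : ρ e = 0) :
    f.outflowAt ρ e = 0 := by
  rw [outflowAt_eq, realOutflow_eq_coe,
    f.outflow_of_empty e _ (ofReal_mem_localDomain (localDensity_mem hρ))]
  · simp
  · simp [self, localDensity, he]

theorem ofReal_outflowAt_le {ρ : E → ℝ} (hρ : ρ ∈ N.states) (e : E) :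
    ENNReal.ofReal (f.outflowAt ρ e) ≤ N.capacity e := by
  rw [outflowAt_eq, realOutflow_eq_coe, ENNReal.ofReal_coe_nnreal]
  exact f.outflow_le e _ (ofReal_mem_localDomain (localDensity_mem hρ))

theorem realOutflow_origin {i : N.origins} {x : N.localLinks (Sum.inr i) → ℝ}
    (hx : x ∈ N.localBox (Sum.inr i)) : f.realOutflow (Sum.inr i) x = N.inflow i := by
  rw [realOutflow_eq_coe, f.outflow_origin i _ (ofReal_mem_localDomain hx)]

/-- A link that does not end in a destination has a finite capacity, since its outflow, which is
finite, is equal to the capacity when the link is the only congested one. -/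
theorem capacity_ne_top (f : N.RoutingPolicy) {e : E} (he : N.head e ∉ N.dests) :
    N.capacity e ≠ ⊤ := by
  obtain ⟨k, hk⟩ := exists_tail_eq he
  have hke : k ≠ e := by
    rintro rfl
    exact N.head_ne_tail k hk.symm
  let x : N.localLinks (Sum.inl e) → ℝ≥0∞ := fun l => if l.1 = e then N.buffer e else 0
  have hx : x ∈ N.localDomain (Sum.inl e) := by
    refine ⟨fun l => ?_, ⟨k, mem_localLinks.2 (Or.inl hk)⟩, ?_⟩
    · by_cases h : l.1 = e
      · simp [x, h]
      · simp [x, h]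
    · simpa [x, hke] using (N.buffer_pos k).ne
  rw [← f.outflow_of_congested e x hx (by simp [x, self])]
  exact ENNReal.coe_ne_top

theorem exists_inflowAt_le (f : N.RoutingPolicy) :
    ∃ K : ℝ, 0 < K ∧ ∀ ρ ∈ N.states, ∀ e, f.inflowAt ρ e ≤ K := by
  let c : N.Source → ℝ := Sum.elim (fun e => (N.capacity e).toReal) (fun v => N.inflow v.1)
  have hc0 : ∀ i, 0 ≤ c i := by
    rintro (e | v) <;> simp [c]
  refine ⟨∑ i, c i + 1, by have := Finset.sum_nonneg fun i (_ : i ∈ Finset.univ) => hc0 i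
                           linarith, fun ρ hρ e => ?_⟩
  have : f.inflowAt ρ e ≤ ∑ i, c i := by
    rw [inflowAt_eq]
    refine Finset.sum_le_sum fun i _ => ?_
    by_cases hi : N.targetTail (Sum.inl e) = N.sourceHead i
    · refine (realFlow_le_realOutflow i _ _).trans ?_
      rcases i with l | v
      · have hl : N.head l ∉ N.dests := by
          have : N.tail e = N.head l := hi
          rw [← this]
          exact not_mem_dests_tail e
        have := ofReal_outflowAt_le (f := f) hρ l
        exact (ENNReal.ofReal_le_iff_le_toReal (capacity_ne_top f hl)).1 this
      · exact (realOutflow_origin (localDensity_mem hρ)).le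
    · rw [realFlow_eq_zero hi (localDensity_mem hρ)]
      exact hc0 i
  linarith

end RoutingPolicy

end FlowNetwork

/-! ### Comparison of solutions -/

theorem hasDerivAt_posPart_sq (s : ℝ) :
    HasDerivAt (fun r : ℝ => (max r 0) ^ 2) (2 * max s 0) s := by
  rcases lt_trichotomy s 0 with h | h | h
  · have : (fun r : ℝ => (max r 0) ^ 2) =ᶠ[𝓝 s] fun _ => 0 := by
      filter_upwards [Iio_mem_nhds h] with r hr
      simp [max_eq_right (mem_Iio.1 hr).le]
    rw [max_eq_right h.le, mul_zero]
    exact (hasDerivAt_const s (0 : ℝ)).congr_of_eventuallyEq this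
  · subst h
    rw [hasDerivAt_iff_isLittleO_nhds_zero]
    refine Asymptotics.IsBigO.trans_isLittleO (g := fun r : ℝ => r ^ 2) ?_
      (Asymptotics.isLittleO_pow_id one_lt_two)
    refine Asymptotics.IsBigO.of_bound 1 (Eventually.of_forall fun r => ?_)
    simp only [zero_add, max_self, ne_eq, OfNat.ofNat_ne_zero, not_false_eq_true, zero_pow,
      sub_zero, mul_zero, smul_zero, norm_pow, Real.norm_eq_abs, one_mul]
    rw [sq_le_sq, abs_abs, abs_abs]
    rcases le_total r 0 with hr | hr
    · simp [hr]
    · simp [hr]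
  · have : (fun r : ℝ => (max r 0) ^ 2) =ᶠ[𝓝 s] fun r => r ^ 2 := by
      filter_upwards [Ioi_mem_nhds h] with r hr
      simp [max_eq_left (mem_Ioi.1 hr).le]
    rw [max_eq_left h.le]
    simpa using (hasDerivAt_pow 2 s).congr_of_eventuallyEq this

/-- Grönwall's inequality with initial value zero. -/
theorem nonpos_of_hasDerivWithinAt_le_mul {W W' : ℝ → ℝ} {K a b : ℝ} (hW : ContinuousOn W (Icc a b))
    (hW' : ∀ t ∈ Ico a b, HasDerivWithinAt W (W' t) (Ici t) t) (ha : W a ≤ 0)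
    (hb : ∀ t ∈ Ico a b, W' t ≤ K * W t) : ∀ t ∈ Icc a b, W t ≤ 0 := by
  intro t ht
  have := le_gronwallBound_of_liminf_deriv_right_le hW (f' := W') (K := K) (ε := 0) (δ := 0)
    (fun x hx r hr => (hW' x hx).liminf_right_slope_le hr) ha
    (fun x hx => by simpa using hb x hx) t ht
  rwa [gronwallBound_ε0_δ0] at this

namespace FlowNetwork

theorem timeInterval_ofReal (T : ℝ) : timeInterval (ENNReal.ofReal T) = Ico 0 T := by
  ext t
  refine and_congr_right fun h => ?_
  exact ENNReal.ofReal_lt_ofReal_iff_of_nonneg h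

theorem timeInterval_top : timeInterval ⊤ = Ici 0 := by
  ext t
  simp [timeInterval]

theorem mem_timeInterval_of_le {T : ℝ≥0∞} {s t : ℝ} (ht : t ∈ timeInterval T) (h0 : 0 ≤ s)
    (hst : s ≤ t) : s ∈ timeInterval T :=
  ⟨h0, (ENNReal.ofReal_le_ofReal hst).trans_lt ht.2⟩

theorem ordConnected_timeInterval (T : ℝ≥0∞) : (timeInterval T).OrdConnected :=
  ⟨fun _ hx _ hy _ hz => mem_timeInterval_of_le hy (hx.1.trans hz.1) hz.2⟩

theorem isOpen_setOf_ofReal_lt (T : ℝ≥0∞) : IsOpen {t : ℝ | ENNReal.ofReal t < T} :=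
  isOpen_lt ENNReal.continuous_ofReal continuous_const

theorem timeInterval_mem_nhdsGE {T : ℝ≥0∞} {t : ℝ} (ht : t ∈ timeInterval T) :
    timeInterval T ∈ 𝓝[≥] t := by
  filter_upwards [self_mem_nhdsWithin,
    nhdsWithin_le_nhds ((isOpen_setOf_ofReal_lt T).mem_nhds ht.2)] with s hs hs'
    using ⟨ht.1.trans hs, hs'⟩

theorem timeInterval_mem_nhds {T : ℝ≥0∞} {t : ℝ} (ht : t ∈ timeInterval T) (h0 : 0 < t) :
    timeInterval T ∈ 𝓝 t := by
  filter_upwards [Ioi_mem_nhds h0, (isOpen_setOf_ofReal_lt T).mem_nhds ht.2] with s hs hs'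
    using ⟨le_of_lt hs, hs'⟩

theorem timeInterval_mem_nhdsWithin {T T' : ℝ≥0∞} {t : ℝ} (ht : t ∈ timeInterval T) :
    timeInterval T ∈ 𝓝[timeInterval T'] t := by
  filter_upwards [self_mem_nhdsWithin,
    nhdsWithin_le_nhds ((isOpen_setOf_ofReal_lt T).mem_nhds ht.2)] with s hs hs'
    using ⟨hs.1, hs'⟩

variable {V E : Type*} [Fintype V] [DecidableEq V] [Fintype E] [DecidableEq E]
  {N : FlowNetwork V E}

namespace RoutingPolicy

variable {f : N.RoutingPolicy} {ρ₀ σ₀ : E → ℝ} {T T' : ℝ≥0∞} {ρ σ : ℝ → E → ℝ}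

theorem IsSolution.hasDerivWithinAt_Ici (h : f.IsSolution ρ₀ T ρ) {t : ℝ}
    (ht : t ∈ timeInterval T) (e : E) :
    HasDerivWithinAt (fun s => ρ s e) (f.drift (ρ t) e) (Ici t) t :=
  ((h.2 t ht).2 e).mono_of_mem_nhdsWithin (timeInterval_mem_nhdsGE ht)

theorem IsSolution.hasDerivAt (h : f.IsSolution ρ₀ T ρ) {t : ℝ}
    (ht : t ∈ timeInterval T) (h0 : 0 < t) (e : E) :
    HasDerivAt (fun s => ρ s e) (f.drift (ρ t) e) t :=
  ((h.2 t ht).2 e).hasDerivAt (timeInterval_mem_nhds ht h0)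

theorem IsSolution.continuousOn (h : f.IsSolution ρ₀ T ρ) : ContinuousOn ρ (timeInterval T) :=
  continuousOn_pi.2 fun e t ht => ((h.2 t ht).2 e).continuousWithinAt

theorem IsSolution.exists_bound (h : f.IsSolution ρ₀ T ρ) {t : ℝ} (ht : t ∈ timeInterval T) :
    ∃ b ∈ N.states, ∀ s ∈ Icc 0 t, ρ s ≤ b := by
  have hsub : Icc 0 t ⊆ timeInterval T := fun s hs => mem_timeInterval_of_le ht hs.1 hs.2
  have : ∀ e, ∃ s ∈ Icc 0 t, IsMaxOn (fun s => ρ s e) (Icc 0 t) s := fun e =>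
    isCompact_Icc.exists_isMaxOn ⟨0, le_rfl, ht.1⟩
      ((continuousOn_pi.1 h.continuousOn e).mono hsub)
  choose s hs hmax using this
  exact ⟨fun e => ρ (s e) e, fun e => (h.2 _ (hsub (hs e))).1 e, fun r hr e => hmax e hr⟩

/-- Solutions of a monotone policy preserve the componentwise order. The sum of the squares of the
positive parts of `ρ e - σ e` satisfies a linear differential inequality, because the vector field
is quasimonotone and locally Lipschitz. -/
theorem IsSolution.le (hf : f.IsMonotone) (hρ : f.IsSolution ρ₀ T ρ) (hσ : f.IsSolution σ₀ T' σ)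
    (h0 : ρ₀ ≤ σ₀) {t : ℝ} (ht : t ∈ timeInterval T) (ht' : t ∈ timeInterval T') :
    ρ t ≤ σ t := by
  obtain ⟨b₁, hb₁, hρb⟩ := hρ.exists_bound ht
  obtain ⟨b₂, hb₂, hσb⟩ := hσ.exists_bound ht'
  obtain ⟨K, hK⟩ := exists_lipschitzOnWith_drift f (sup_mem_densityBox hb₁ hb₂)
  have hsub : Icc 0 t ⊆ timeInterval T := fun s hs => mem_timeInterval_of_le ht hs.1 hs.2
  have hsub' : Icc 0 t ⊆ timeInterval T' := fun s hs => mem_timeInterval_of_le ht' hs.1 hs.2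
  set W : ℝ → ℝ := fun s => ∑ e, (max (ρ s e - σ s e) 0) ^ 2
  set W' : ℝ → ℝ := fun s =>
    ∑ e, 2 * max (ρ s e - σ s e) 0 * (f.drift (ρ s) e - f.drift (σ s) e)
  have hWle : ∀ s e, (max (ρ s e - σ s e) 0) ^ 2 ≤ W s := fun s e =>
    Finset.single_le_sum (f := fun e => (max (ρ s e - σ s e) 0) ^ 2)
      (fun e _ => sq_nonneg _) (Finset.mem_univ e)
  have hW0 : ∀ s, 0 ≤ W s := fun s => Finset.sum_nonneg fun e _ => sq_nonneg _
  have hcont : ContinuousOn W (Icc 0 t) := by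
    refine continuousOn_finsetSum _ fun e _ => ContinuousOn.pow (ContinuousOn.sup ?_
      continuousOn_const) 2
    exact ((continuousOn_pi.1 hρ.continuousOn e).mono hsub).sub
      ((continuousOn_pi.1 hσ.continuousOn e).mono hsub')
  have hderiv : ∀ s ∈ Ico 0 t, HasDerivWithinAt W (W' s) (Ici s) s := by
    intro s hs
    refine HasDerivWithinAt.fun_sum fun e _ => ?_
    exact (hasDerivAt_posPart_sq (ρ s e - σ s e)).comp_hasDerivWithinAt s
      ((hρ.hasDerivWithinAt_Ici (hsub (Ico_subset_Icc_self hs)) e).sub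
        (hσ.hasDerivWithinAt_Ici (hsub' (Ico_subset_Icc_self hs)) e))
  have hbound : ∀ s ∈ Ico 0 t, W' s ≤ (Fintype.card E * (2 * K)) * W s := by
    intro s hs'
    have hs := Ico_subset_Icc_self hs'
    have hx := (hρ.2 s (hsub hs)).1
    have hy := (hσ.2 s (hsub' hs)).1
    have hz : ρ s ⊓ σ s ∈ N.states :=
      mem_densityBox_of_le hx (le_inf (fun e => (hx e).1) (fun e => (hy e).1)) inf_le_left
    have hterm : ∀ e ∈ (Finset.univ : Finset E),
        2 * max (ρ s e - σ s e) 0 * (f.drift (ρ s) e - f.drift (σ s) e) ≤ 2 * K * W s := by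
      intro e _
      rcases le_total (ρ s e) (σ s e) with h | h
      · rw [max_eq_right (sub_nonpos.2 h)]
        have := hW0 s
        simp only [mul_zero, zero_mul]
        positivity
      · have h1 : f.drift (ρ s ⊓ σ s) e ≤ f.drift (σ s) e :=
          hf.drift_le hz hy inf_le_right (by simpa using h)
        have h2 : f.drift (ρ s) e - f.drift (ρ s ⊓ σ s) e ≤ K * dist (ρ s) (ρ s ⊓ σ s) := by
          refine (le_abs_self _).trans ((hK e).dist_le_mul _ ?_ _ ?_)
          · exact ⟨fun e => (hx e).1, (hρb s hs).trans le_sup_left⟩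
          · exact ⟨fun e => (hz e).1, inf_le_left.trans ((hρb s hs).trans le_sup_left)⟩
        have h3 : dist (ρ s) (ρ s ⊓ σ s) ≤ √(W s) := by
          rw [dist_pi_le_iff (Real.sqrt_nonneg _)]
          intro e'
          refine Real.le_sqrt_of_sq_le ((le_of_eq ?_).trans (hWle s e'))
          rw [Real.dist_eq, sq_abs]
          congr 1
          rcases le_total (ρ s e') (σ s e') with h' | h'
          · simp [h']
          · simp [h']
        have h4 : max (ρ s e - σ s e) 0 ≤ √(W s) := Real.le_sqrt_of_sq_le (hWle s e)
        have h5 : f.drift (ρ s) e - f.drift (σ s) e ≤ K * √(W s) := by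
          have := mul_le_mul_of_nonneg_left h3 K.2
          exact (by linarith : _ ≤ _).trans (h2.trans this)
        calc 2 * max (ρ s e - σ s e) 0 * (f.drift (ρ s) e - f.drift (σ s) e)
            ≤ 2 * max (ρ s e - σ s e) 0 * (K * √(W s)) := by gcongr
          _ ≤ 2 * √(W s) * (K * √(W s)) := by gcongr
          _ = 2 * K * (√(W s) * √(W s)) := by ring
          _ = 2 * K * W s := by rw [Real.mul_self_sqrt (hW0 s)]
    refine (Finset.sum_le_sum hterm).trans (le_of_eq ?_)
    simp only [Finset.sum_const, Finset.card_univ, nsmul_eq_mul]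
    ring
  have hinit : W 0 ≤ 0 := by
    refine (Finset.sum_eq_zero fun e _ => ?_).le
    rw [hρ.1, hσ.1, max_eq_right (sub_nonpos.2 (h0 e))]
    simp
  have hWt := nonpos_of_hasDerivWithinAt_le_mul hcont hderiv hinit hbound t ⟨ht.1, le_rfl⟩
  intro e
  have h1 := (hWle t e).trans hWt
  have h2 : max (ρ t e - σ t e) 0 = 0 := by nlinarith [sq_nonneg (max (ρ t e - σ t e) 0)]
  linarith [le_max_left (ρ t e - σ t e) 0]

theorem IsSolution.eqOn (hf : f.IsMonotone) (hρ : f.IsSolution ρ₀ T ρ)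
    (hσ : f.IsSolution ρ₀ T' σ) : EqOn ρ σ (timeInterval T ∩ timeInterval T') := fun _ ht =>
  le_antisymm (hρ.le hf hσ le_rfl ht.1 ht.2) (hσ.le hf hρ le_rfl ht.2 ht.1)

/-! ### Existence of solutions -/

theorem drift_nonneg_of_eq_zero {x : E → ℝ} (hx : x ∈ N.states) {e : E} (he : x e = 0) :
    0 ≤ f.drift x e := by
  rw [drift, outflowAt_of_eq_zero hx he, sub_zero]
  exact inflowAt_nonneg x e

/-- Local existence. The Picard-Lindelöf theorem is applied to the vector field composed with the
projection to a compact box, which is globally Lipschitz and bounded. -/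
theorem exists_isSolution (f : N.RoutingPolicy) (h₀ : ρ₀ ∈ N.states) :
    ∃ ε > 0, ∃ ρ, f.IsSolution ρ₀ (ENNReal.ofReal ε) ρ := by
  have : ∀ e, ∃ b : ℝ, ρ₀ e < b ∧ 0 ≤ b ∧ ENNReal.ofReal b < N.buffer e := by
    intro e
    obtain ⟨r, hr, hr'⟩ := ENNReal.lt_iff_exists_nnreal_btwn.1 (h₀ e).2
    refine ⟨r, ?_, r.2, by simpa using hr'⟩
    rw [ENNReal.ofReal_lt_iff_lt_toReal (h₀ e).1 ENNReal.coe_ne_top] at hr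
    simpa using hr
  choose b hρb hb0 hbB using this
  have hb : b ∈ N.states := fun e => ⟨hb0 e, hbB e⟩
  obtain ⟨K, hK⟩ := exists_lipschitzOnWith_drift f hb
  set p : (E → ℝ) → E → ℝ := fun x => 0 ⊔ (x ⊓ b)
  have hp : ∀ x, p x ∈ Icc 0 b := fun x => ⟨le_sup_left, sup_le (fun e => hb0 e) inf_le_right⟩
  have hpid : ∀ x ∈ Icc 0 b, p x = x := fun x hx => by
    simp only [p]
    rw [inf_eq_left.2 hx.2, sup_eq_right.2 hx.1]
  have hps : ∀ x, p x ∈ N.states := fun x => mem_densityBox_of_le hb (hp x).1 (hp x).2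
  have hplip : LipschitzWith 1 p := by
    refine LipschitzWith.of_dist_le_mul fun x y => ?_
    rw [NNReal.coe_one, one_mul, dist_pi_le_iff dist_nonneg]
    intro e
    refine le_trans ?_ (dist_le_pi_dist x y e)
    simp only [p, Pi.sup_apply, Pi.inf_apply, Pi.zero_apply, Real.dist_eq]
    refine (abs_max_sub_max_le_max _ _ _ _).trans ?_
    simp only [sub_self, abs_zero]
    refine max_le (abs_nonneg _) ((abs_min_sub_min_le_max _ _ _ _).trans ?_)
    simp
  set G : (E → ℝ) → E → ℝ := fun x => f.drift (p x)
  have hGlip : LipschitzWith K G := by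
    refine LipschitzWith.of_dist_le_mul fun x y => ?_
    rw [dist_pi_le_iff (by positivity)]
    intro e
    refine ((hK e).dist_le_mul _ (hp x) _ (hp y)).trans ?_
    gcongr
    simpa using hplip.dist_le_mul x y
  obtain ⟨L, hL⟩ := (isCompact_Icc (a := (0 : E → ℝ)) (b := b)).exists_bound_of_continuousOn
    (continuousOn_drift.mono fun x hx => mem_densityBox_of_le hb hx.1 hx.2 :
      ContinuousOn f.drift (Icc 0 b))
  have hGL : ∀ x, ‖G x‖ ≤ L.toNNReal := fun x => (hL _ (hp x)).trans (Real.le_coe_toNNReal L)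
  have hPL : IsPicardLindelof (fun _ => G) (tmin := 0) (tmax := 1) ⟨0, by simp⟩ ρ₀
      L.toNNReal 0 L.toNNReal K :=
    IsPicardLindelof.of_time_independent (fun x _ => hGL x) hGlip.lipschitzOnWith (by simp)
  obtain ⟨α, hα0, hα⟩ := hPL.exists_eq_forall_mem_Icc_hasDerivWithinAt₀
  simp only at hα0
  have hαe : ∀ e, ∀ t ∈ Icc (0 : ℝ) 1,
      HasDerivWithinAt (fun s => α s e) (G (α t) e) (Icc 0 1) t := fun e t ht =>
    hasDerivWithinAt_pi.1 (hα t ht) e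
  have hcont : ContinuousOn α (Icc 0 1) := fun t ht => (hα t ht).continuousWithinAt
  -- where a component of `α` is negative, its derivative is an inflow, hence nonnegative
  have hnonneg : ∀ t ∈ Icc (0 : ℝ) 1, ∀ e, 0 ≤ α t e := by
    intro t ht e
    have := nonpos_of_hasDerivWithinAt_le_mul (K := 0) (a := 0) (b := 1)
      (W := fun s => (max (-α s e) 0) ^ 2)
      (W' := fun s => 2 * max (-α s e) 0 * -G (α s) e)
      ((((continuousOn_pi.1 hcont e).neg).sup continuousOn_const).pow 2) ?_ ?_ ?_ t ht
    · have h2 : max (-α t e) 0 = 0 := by nlinarith [sq_nonneg (max (-α t e) 0)]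
      linarith [le_max_left (-α t e) 0]
    · intro s hs
      refine HasDerivAt.comp_hasDerivWithinAt (h := fun s => -α s e) s
        (hasDerivAt_posPart_sq (-α s e)) ?_
      exact ((hαe e s (Ico_subset_Icc_self hs)).mono_of_mem_nhdsWithin
        (mem_of_superset (Icc_mem_nhdsGE hs.2) (Icc_subset_Icc_left hs.1))).neg
    · have : α 0 e = ρ₀ e := by rw [hα0]
      rw [this, max_eq_right (by linarith [(h₀ e).1])]
      simp
    · intro s hs
      rcases le_total 0 (α s e) with h | h
      · rw [max_eq_right (by linarith)]
        simp
      · have h1 : p (α s) e = 0 := by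
          simp only [p, Pi.sup_apply, Pi.inf_apply, Pi.zero_apply]
          exact max_eq_left ((min_le_left _ _).trans h)
        have h2 : 0 ≤ G (α s) e := drift_nonneg_of_eq_zero (hps _) h1
        have h3 : 0 ≤ max (-α s e) 0 := le_max_right _ _
        nlinarith
  have hev : ∀ᶠ t in 𝓝[≥] (0 : ℝ), t ∈ Icc (0 : ℝ) 1 ∧ ∀ e, α t e < b e := by
    refine (Filter.Eventually.and (Icc_mem_nhdsGE one_pos) (eventually_all.2 fun e => ?_))
    have h1 : ContinuousWithinAt (fun s => α s e) (Icc 0 1) 0 :=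
      (continuousOn_pi.1 hcont e) 0 (by simp)
    have h2 : Tendsto (fun s => α s e) (𝓝[≥] 0) (𝓝 (α 0 e)) :=
      h1.tendsto.mono_left (nhdsWithin_le_of_mem (Icc_mem_nhdsGE one_pos))
    exact h2.eventually_lt_const (by rw [hα0]; exact hρb e)
  obtain ⟨ε, hε, hεs⟩ := mem_nhdsGE_iff_exists_Ico_subset.1 hev
  refine ⟨ε, hε, α, hα0, fun t ht => ?_⟩
  rw [timeInterval_ofReal] at ht ⊢
  have hmem : α t ∈ Icc 0 b := ⟨hnonneg t (hεs ht).1, fun e => ((hεs ht).2 e).le⟩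
  refine ⟨mem_densityBox_of_le hb hmem.1 hmem.2, fun e => ?_⟩
  have h1 := (hαe e t (hεs ht).1).mono fun s hs => (hεs hs).1
  simp only [G] at h1
  rwa [hpid _ hmem] at h1

/-- A solution that converges in the state space at a finite time can be continued. -/
theorem IsSolution.exists_extension {T : ℝ} (hT : 0 < T)
    (h : f.IsSolution ρ₀ (ENNReal.ofReal T) ρ) {p : E → ℝ} (hp : p ∈ N.states)
    (hlim : Tendsto ρ (𝓝[<] T) (𝓝 p)) :
    ∃ T' > T, ∃ ρ', f.IsSolution ρ₀ (ENNReal.ofReal T') ρ' := by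
  obtain ⟨ε, hε, y, hy⟩ := exists_isSolution f hp
  set z : ℝ → E → ℝ := fun t => if t < T then ρ t else y (t - T)
  have hzl : ∀ t < T, z t = ρ t := fun t ht => if_pos ht
  have hzr : ∀ t, T ≤ t → z t = y (t - T) := fun t ht => if_neg ht.not_gt
  have hmemρ : ∀ {t}, 0 ≤ t → t < T → t ∈ timeInterval (ENNReal.ofReal T) := fun h0 h1 => by
    rw [timeInterval_ofReal]; exact ⟨h0, h1⟩
  have hmemy : ∀ {t}, T ≤ t → t < T + ε → t - T ∈ timeInterval (ENNReal.ofReal ε) :=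
    fun h0 h1 => by
      rw [timeInterval_ofReal]; exact ⟨by linarith, by linarith⟩
  refine ⟨T + ε, by linarith, z, ?_, ?_⟩
  · rw [hzl 0 hT, h.1]
  intro t ht
  have ht' := ht
  rw [timeInterval_ofReal] at ht'
  rcases lt_trichotomy t T with htT | htT | htT
  · have hm := hmemρ ht'.1 htT
    rw [hzl t htT]
    refine ⟨(h.2 t hm).1, fun e => ?_⟩
    refine (((h.2 t hm).2 e).mono_of_mem_nhdsWithin
      (timeInterval_mem_nhdsWithin hm)).congr_of_eventuallyEq ?_ (by rw [hzl t htT])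
    filter_upwards [nhdsWithin_le_nhds (Iio_mem_nhds htT)] with s hs
    rw [hzl s hs]
  · subst htT
    have hzt : z t = p := by rw [hzr t le_rfl, sub_self, hy.1]
    rw [hzt]
    refine ⟨hp, fun e => ?_⟩
    have hIoo : ∀ s ∈ Ioo 0 t, HasDerivAt (fun s => z s e) (f.drift (ρ s) e) s := by
      intro s hs
      refine (h.hasDerivAt (hmemρ hs.1.le hs.2) hs.1 e).congr_of_eventuallyEq ?_
      filter_upwards [Iio_mem_nhds hs.2] with r hr
      rw [hzl r hr]
    have hleft : HasDerivWithinAt (fun s => z s e) (f.drift p e) (Iic t) t := by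
      refine hasDerivWithinAt_Iic_of_tendsto_deriv (s := Ioo 0 t)
        (fun s hs => (hIoo s hs).differentiableAt.differentiableWithinAt) ?_
        (Ioo_mem_nhdsLT hT) ?_
      · rw [ContinuousWithinAt, hzt]
        have h1 := (tendsto_pi_nhds.1 hlim e).mono_left
          (nhdsWithin_mono t (fun s hs => hs.2 : Ioo 0 t ⊆ Iio t))
        refine h1.congr' ?_
        filter_upwards [self_mem_nhdsWithin] with s hs
        rw [hzl s hs.2]
      · have h1 : Tendsto ρ (𝓝[<] t) (𝓝[N.states] p) := by
          refine tendsto_nhdsWithin_iff.2 ⟨hlim, ?_⟩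
          filter_upwards [Ioo_mem_nhdsLT hT] with s hs
          exact (h.2 s (hmemρ hs.1.le hs.2)).1
        have h2 := tendsto_pi_nhds.1 ((continuousOn_drift (f := f) p hp).tendsto.comp h1) e
        refine h2.congr' ?_
        filter_upwards [Ioo_mem_nhdsLT hT] with s hs
        exact (hIoo s hs).deriv.symm
    have hright : HasDerivWithinAt (fun s => z s e) (f.drift p e) (Ici t) t := by
      have h0 : (0 : ℝ) ∈ timeInterval (ENNReal.ofReal ε) := by
        rw [timeInterval_ofReal]; exact ⟨le_rfl, hε⟩
      have h1 := hy.hasDerivWithinAt_Ici h0 e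
      rw [hy.1] at h1
      have h2 : HasDerivWithinAt (fun s => s - t) 1 (Ici t) t :=
        (hasDerivWithinAt_id t _).sub_const t
      have h3 := HasDerivWithinAt.scomp_of_eq (t' := Ici (0 : ℝ)) t h1 h2
        (fun s hs => by simpa using hs) (by simp)
      rw [one_smul] at h3
      refine h3.congr (fun s hs => ?_) ?_
      · simp only [hzr s hs, Function.comp]
      · simp only [hzr t le_rfl, Function.comp]
    have := hleft.union hright
    rw [Iic_union_Ici] at this
    exact this.mono (subset_univ _)
  · have hm := hmemy htT.le ht'.2
    rw [hzr t htT.le]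
    refine ⟨(hy.2 _ hm).1, fun e => ?_⟩
    have h1 := (hy.hasDerivAt hm (by linarith) e).comp_sub_const t T
    refine (h1.congr_of_eventuallyEq ?_).hasDerivWithinAt
    filter_upwards [Ioi_mem_nhds htT] with s hs
    rw [hzr s (le_of_lt hs)]

theorem exitTime_pos (f : N.RoutingPolicy) (h₀ : ρ₀ ∈ N.states) : 0 < f.exitTime ρ₀ := by
  obtain ⟨ε, hε, ρ, hρ⟩ := exists_isSolution f h₀
  exact (ENNReal.ofReal_pos.2 hε).trans_le (le_sSup ⟨ρ, hρ⟩)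

theorem exists_isSolution_exitTime (hf : f.IsMonotone) (ρ₀ : E → ℝ) :
    ∃ ρ, f.IsSolution ρ₀ (f.exitTime ρ₀) ρ := by
  by_cases hpos : f.exitTime ρ₀ = 0
  · refine ⟨fun _ => ρ₀, rfl, fun t ht => ?_⟩
    rw [hpos] at ht
    exact absurd ht.2 not_lt_zero
  have : ∀ t : ℝ, ∃ (T : ℝ≥0∞) (σ : ℝ → E → ℝ), t ∈ timeInterval (f.exitTime ρ₀) →
      t ∈ timeInterval T ∧ f.IsSolution ρ₀ T σ := by
    intro t
    by_cases ht : t ∈ timeInterval (f.exitTime ρ₀)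
    · obtain ⟨T, ⟨σ, hσ⟩, hT⟩ := lt_sSup_iff.1 ht.2
      exact ⟨T, σ, fun _ => ⟨⟨ht.1, hT⟩, hσ⟩⟩
    · exact ⟨0, 0, fun h => absurd h ht⟩
  choose T σ hσ using this
  have h0 : (0 : ℝ) ∈ timeInterval (f.exitTime ρ₀) :=
    ⟨le_rfl, by simpa using pos_iff_ne_zero.2 hpos⟩
  refine ⟨fun t => σ t t, (hσ 0 h0).2.1, fun t ht => ?_⟩
  obtain ⟨hmem, hsol⟩ := hσ t ht
  refine ⟨(hsol.2 t hmem).1, fun e => ?_⟩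
  refine (((hsol.2 t hmem).2 e).mono_of_mem_nhdsWithin
    (timeInterval_mem_nhdsWithin hmem)).congr_of_eventuallyEq ?_ rfl
  filter_upwards [self_mem_nhdsWithin, timeInterval_mem_nhdsWithin hmem] with s hs hs'
  rw [(hσ s hs).2.eqOn hf hsol ⟨(hσ s hs).1, hs'⟩]

end RoutingPolicy

end FlowNetwork

namespace FlowNetwork

/-! ### The end of the time interval -/

/-- The filter on the real line of the times that approach the end of `[0, T)` from the left; it is
`𝓝[<] T` for finite `T` and `atTop` for `T = ∞`. -/
def endFilter (T : ℝ≥0∞) : Filter ℝ := map ENNReal.toReal (𝓝[<] T)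

theorem toReal_mem_timeInterval {T t : ℝ≥0∞} (h : t < T) : t.toReal ∈ timeInterval T :=
  ⟨ENNReal.toReal_nonneg, by rwa [ENNReal.ofReal_toReal h.ne_top]⟩

theorem eventually_endFilter {T : ℝ≥0∞} (hT : 0 < T) {P : ℝ → Prop} :
    (∀ᶠ t in endFilter T, P t) ↔ ∃ a ∈ timeInterval T, ∀ t ∈ timeInterval T, a ≤ t → P t := by
  rw [endFilter, eventually_map, (nhdsLT_basis_of_exists_lt ⟨0, hT⟩).eventually_iff]
  constructor
  · rintro ⟨a, ha, h⟩
    obtain ⟨b, hab, hbT⟩ := exists_between ha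
    refine ⟨b.toReal, toReal_mem_timeInterval hbT, fun t ht hbt => ?_⟩
    have h1 : b ≤ ENNReal.ofReal t := (ENNReal.le_ofReal_iff_toReal_le hbT.ne_top ht.1).2 hbt
    have := h ⟨hab.trans_le h1, ht.2⟩
    rwa [ENNReal.toReal_ofReal ht.1] at this
  · rintro ⟨a, ha, h⟩
    refine ⟨ENNReal.ofReal a, ha.2, fun t ht => h _ (toReal_mem_timeInterval ht.2) ?_⟩
    exact (ENNReal.ofReal_le_iff_le_toReal ht.2.ne_top).1 ht.1.le

theorem endFilter_neBot {T : ℝ≥0∞} (hT : 0 < T) : (endFilter T).NeBot := by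
  have : (𝓝[<] T).NeBot := nhdsLT_neBot_of_exists_lt ⟨0, hT⟩
  exact this.map _

theorem eventually_endFilter_mem {T : ℝ≥0∞} (hT : 0 < T) :
    ∀ᶠ t in endFilter T, t ∈ timeInterval T :=
  (eventually_endFilter hT).2 ⟨0, ⟨le_rfl, by simpa using hT⟩, fun _ h _ => h⟩

theorem endFilter_top : endFilter ⊤ = atTop := by
  ext s
  refine (eventually_endFilter ENNReal.zero_lt_top).trans ?_
  rw [mem_atTop_sets, timeInterval_top]
  constructor
  · rintro ⟨a, ha, h⟩
    exact ⟨a, fun t hat => h t (le_trans ha hat) hat⟩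
  · rintro ⟨a, h⟩
    exact ⟨max a 0, mem_Ici.2 (le_max_right _ _), fun t _ hat => h t ((le_max_left _ _).trans hat)⟩

theorem endFilter_ofReal {T : ℝ} (hT : 0 < T) : endFilter (ENNReal.ofReal T) = 𝓝[<] T := by
  ext s
  refine (eventually_endFilter (ENNReal.ofReal_pos.2 hT)).trans ?_
  rw [timeInterval_ofReal, mem_nhdsLT_iff_exists_Ico_subset]
  constructor
  · rintro ⟨a, ha, h⟩
    exact ⟨a, ha.2, fun t ht => h t ⟨ha.1.trans ht.1, ht.2⟩ ht.1⟩
  · rintro ⟨a, ha, h⟩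
    exact ⟨max a 0, ⟨le_max_right _ _, max_lt ha hT⟩,
      fun t ht hat => h ⟨(le_max_left _ _).trans hat, ht.2⟩⟩

theorem tendsto_endFilter_of_monotoneOn {α : Type*} [LinearOrder α] [TopologicalSpace α]
    [OrderTopology α] {T : ℝ≥0∞} (hT : 0 < T) {g : ℝ → α} (hg : MonotoneOn g (timeInterval T))
    {l : α} (hl : IsLUB (g '' timeInterval T) l) : Tendsto g (endFilter T) (𝓝 l) := by
  refine tendsto_order.2 ⟨fun a ha => ?_, fun a ha => ?_⟩
  · obtain ⟨_, ⟨t, ht, rfl⟩, hat⟩ := (lt_isLUB_iff hl).1 ha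
    exact (eventually_endFilter hT).2 ⟨t, ht, fun s hs hts => hat.trans_le (hg ht hs hts)⟩
  · filter_upwards [eventually_endFilter_mem hT] with t ht
    exact (hl.1 ⟨t, ht, rfl⟩).trans_lt ha

theorem tendsto_endFilter_of_antitoneOn {α : Type*} [LinearOrder α] [TopologicalSpace α]
    [OrderTopology α] {T : ℝ≥0∞} (hT : 0 < T) {g : ℝ → α} (hg : AntitoneOn g (timeInterval T))
    {l : α} (hl : IsGLB (g '' timeInterval T) l) : Tendsto g (endFilter T) (𝓝 l) :=
  tendsto_endFilter_of_monotoneOn (α := αᵒᵈ) hT hg.dual_right hl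

theorem antitoneOn_of_hasDerivWithinAt_timeInterval {T : ℝ≥0∞} {g g' : ℝ → ℝ} {a : ℝ}
    (hg : ∀ t ∈ timeInterval T, HasDerivWithinAt g (g' t) (timeInterval T) t)
    (hg' : ∀ t ∈ timeInterval T, a ≤ t → g' t ≤ 0) : AntitoneOn g (Ici a ∩ timeInterval T) := by
  have hsub : interior (Ici a ∩ timeInterval T) ⊆ Ici a ∩ timeInterval T := interior_subset
  refine antitoneOn_of_hasDerivWithinAt_nonpos (f' := g')
    (ordConnected_Ici.inter (ordConnected_timeInterval T)).convex ?_ ?_ ?_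
  · exact fun t ht => (hg t ht.2).continuousWithinAt.mono inter_subset_right
  · exact fun t ht => (hg t (hsub ht).2).mono (hsub.trans inter_subset_right)
  · exact fun t ht => hg' t (hsub ht).2 (hsub ht).1

variable {V E : Type*} [Fintype V] [DecidableEq V] [Fintype E] [DecidableEq E]
  {N : FlowNetwork V E}

theorem mem_cuts {U : Finset V} : U ∈ N.cuts ↔ U.Nonempty ∧ Disjoint U N.dests := by
  simp [cuts]

namespace RoutingPolicy

variable {f : N.RoutingPolicy} {ρ₀ : E → ℝ} {T : ℝ≥0∞} {ρ : ℝ → E → ℝ}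

/-! ### Flow balance -/

theorem inflowAt_eq_coe (ρ : E → ℝ) (e : E) : f.inflowAt ρ e =
    ((∑ i, f.flow i (fun k => ENNReal.ofReal (ρ k)) (Sum.inl e) : ℝ≥0) : ℝ) := by
  simp [inflowAt, realFlow]

theorem outflowAt_eq_coe (ρ : E → ℝ) (e : E) : f.outflowAt ρ e =
    ((∑ j, f.flow (Sum.inl e) (fun k => ENNReal.ofReal (ρ k)) j : ℝ≥0) : ℝ) :=
  realOutflow_eq_coe _ _

theorem sum_realFlow_tail_mem {U : Finset V} (hU : Disjoint U N.dests) (i : N.Source)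
    {x : N.localLinks i → ℝ} (hx : x ∈ N.localBox i) :
    ∑ e with N.tail e ∈ U, f.realFlow i (Sum.inl e) x =
      if N.sourceHead i ∈ U then f.realOutflow i x else 0 := by
  split_ifs with h
  · rw [realOutflow, Fintype.sum_sum_type]
    have h1 : ∑ d : N.dests, f.realFlow i (Sum.inr d) x = 0 := by
      refine Finset.sum_eq_zero fun d _ => realFlow_eq_zero (fun hd => ?_) hx
      exact Finset.disjoint_left.1 hU h (hd ▸ d.2)
    rw [h1, add_zero]
    refine Finset.sum_subset (Finset.filter_subset _ _) fun e _ he => realFlow_eq_zero ?_ hx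
    rintro (hd : N.tail e = _)
    exact he (by simpa [hd] using h)
  · refine Finset.sum_eq_zero fun e he => realFlow_eq_zero ?_ hx
    rintro (hd : N.tail e = _)
    rw [Finset.mem_filter, hd] at he
    exact h he.2

theorem sum_origins (U : Finset V) :
    ∑ v : N.origins, (if v.1 ∈ U then (N.inflow v.1 : ℝ) else 0) = N.cutInflow U := by
  rw [Finset.sum_coe_sort N.origins fun v => if v ∈ U then (N.inflow v : ℝ) else 0, cutInflow,
    NNReal.coe_sum, ← Finset.sum_filter]
  refine Finset.sum_subset (fun v hv => (Finset.mem_filter.1 hv).2) fun v hv hv' => ?_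
  by_contra h
  refine hv' (Finset.mem_filter.2 ⟨?_, hv⟩)
  have : 0 < N.inflow v := pos_iff_ne_zero.2 fun h0 => h (by simp [h0])
  simpa [origins] using this

/-- The flow into the links that start in `U` comes from outside the network and from the links
that end in `U`. -/
theorem sum_inflowAt_tail_mem {U : Finset V} (hU : Disjoint U N.dests) {ρ : E → ℝ}
    (hρ : ρ ∈ N.states) : ∑ e with N.tail e ∈ U, f.inflowAt ρ e =
      N.cutInflow U + ∑ e with N.head e ∈ U, f.outflowAt ρ e := by
  simp only [inflowAt_eq]
  rw [Finset.sum_comm]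
  simp only [sum_realFlow_tail_mem hU _ (localDensity_mem hρ)]
  rw [Fintype.sum_sum_type, add_comm]
  congr 1
  · rw [← sum_origins]
    refine Finset.sum_congr rfl fun v _ => ?_
    rw [realOutflow_origin (localDensity_mem hρ)]
    rfl
  · rw [Finset.sum_filter]
    rfl

theorem IsEquilibrium.cutInflow_le {ρ : E → ℝ} (h : f.IsEquilibrium ρ) {U : Finset V}
    (hU : Disjoint U N.dests) :
    N.cutInflow U ≤ ∑ e with N.tail e ∈ U ∧ N.head e ∉ U, f.outflowAt ρ e := by
  have h1 := sum_inflowAt_tail_mem (f := f) hU h.1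
  rw [Finset.sum_congr rfl fun e _ => h.2 e] at h1
  have h2 := Finset.sum_filter_add_sum_filter_not
    (Finset.univ.filter fun e => N.tail e ∈ U) (fun e => N.head e ∈ U) (fun e => f.outflowAt ρ e)
  rw [Finset.filter_filter, Finset.filter_filter] at h2
  have h3 : ∑ e with N.tail e ∈ U ∧ N.head e ∈ U, f.outflowAt ρ e ≤
      ∑ e with N.head e ∈ U, f.outflowAt ρ e :=
    Finset.sum_le_sum_of_subset_of_nonneg
      (Finset.monotone_filter_right _ fun e _ he => he.2)
      fun e _ _ => outflowAt_nonneg ρ e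
  linarith

/-! ### Congestion at the end of the time interval -/

/-- If a solution converges, in the compactified state space, to a point at which some links are
congested, then there is a cut of congested links whose inflow is at least its capacity. Otherwise
the total density of the congested links would decrease near the end of the time interval: the
flow into these links from the other links vanishes in the limit, and those of them that are not
blocked downstream operate at capacity. -/
theorem IsSolution.exists_cut (hT : 0 < T) (h : f.IsSolution ρ₀ T ρ) {b : E → ℝ≥0∞}
    (hb : ∀ e, Tendsto (fun t => ENNReal.ofReal (ρ t e)) (endFilter T) (𝓝 (b e)))
    (hJ : ∃ e, b e = N.buffer e) :
    ∃ S ∈ N.cuts, N.cutCapacity S ≤ N.cutInflow S ∧ ∀ e, N.tail e ∈ S → b e = N.buffer e := by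
  classical
  have := endFilter_neBot hT
  have hmem := eventually_endFilter_mem hT
  have hble : ∀ e, b e ≤ N.buffer e := fun e => le_of_tendsto (hb e) <| by
    filter_upwards [hmem] with t ht using ((h.2 t ht).1 e).2.le
  set J : Finset E := Finset.univ.filter fun e => b e = N.buffer e with hJdef
  have memJ : ∀ {e}, e ∈ J ↔ b e = N.buffer e := by simp [hJdef]
  set S : Finset V := Finset.univ.filter fun v =>
    v ∉ N.dests ∧ ∀ e, N.tail e = v → b e = N.buffer e with hSdef
  have memS : ∀ {v}, v ∈ S ↔ v ∉ N.dests ∧ ∀ e, N.tail e = v → b e = N.buffer e := by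
    simp [hSdef]
  -- the flows, the flows to congested links, and the outflows along the solution
  set φ : (i : N.Source) → ℝ → N.Target → ℝ≥0 := fun i t j =>
    f.flow i (fun k => ENNReal.ofReal (ρ t k)) j with hφ
  set g : N.Source → ℝ → ℝ≥0 := fun i t => ∑ e ∈ J, φ i t (Sum.inl e) with hg
  set o : E → ℝ → ℝ≥0 := fun e t => ∑ j, φ (Sum.inl e) t j with ho
  have hdom : ∀ i, ∀ᶠ t in endFilter T,
      (fun k : N.localLinks i => ENNReal.ofReal (ρ t k)) ∈ N.localDomain i := fun i => by
    filter_upwards [hmem] with t ht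
    exact ofReal_mem_localDomain (localDensity_mem (h.2 t ht).1)
  have hx : ∀ i, Tendsto (fun t => fun k : N.localLinks i => ENNReal.ofReal (ρ t k))
      (endFilter T) (𝓝[N.localDomain i] fun k => b k) := fun i =>
    tendsto_nhdsWithin_iff.2 ⟨tendsto_pi_nhds.2 fun k => hb k, hdom i⟩
  have hφlim : ∀ i, (∃ k ∈ N.localLinks i, k ∉ J) →
      (fun k : N.localLinks i => b k) ∈ N.localDomain i ∧
      ∀ j, Tendsto (fun t => φ i t j) (endFilter T) (𝓝 (f.flow i (fun k => b k) j)) := by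
    rintro i ⟨k, hk, hkJ⟩
    have hd : (fun k : N.localLinks i => b k) ∈ N.localDomain i :=
      ⟨fun k => hble k, ⟨k, hk⟩, fun hk' => hkJ (memJ.2 hk')⟩
    exact ⟨hd, fun j => tendsto_pi_nhds.1 ((f.continuousOn i _ hd).tendsto.comp (hx i)) j⟩
  have hglim : ∀ i, (∃ k ∈ N.localLinks i, k ∉ J) → Tendsto (g i) (endFilter T) (𝓝 0) := by
    intro i hi
    obtain ⟨hd, hlim⟩ := hφlim i hi
    have h0 : ∑ e ∈ J, f.flow i (fun k => b k) (Sum.inl e) = 0 := by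
      refine Finset.sum_eq_zero fun e he => ?_
      by_cases hei : N.tail e = N.sourceHead i
      · exact f.flow_to_congested i _ hd ⟨e, mem_localLinks.2 (Or.inl hei)⟩ hei (memJ.1 he)
      · exact f.flow_eq_zero i _ hd _ hei
    rw [← h0]
    exact tendsto_finsetSum _ fun e _ => hlim _
  have hblock : ∀ e, N.head e ∉ S → N.head e ∉ N.dests →
      ∃ k ∈ N.localLinks (Sum.inl e), k ∉ J := by
    intro e he hed
    have : ¬ ∀ k, N.tail k = N.head e → b k = N.buffer k := fun h' => he (memS.2 ⟨hed, h'⟩)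
    push Not at this
    obtain ⟨k, hk, hkb⟩ := this
    exact ⟨k, mem_localLinks.2 (Or.inl hk), fun hkJ => hkb (memJ.1 hkJ)⟩
  have holim : ∀ e ∈ J, N.head e ∉ S →
      Tendsto (fun t => (o e t : ℝ≥0∞)) (endFilter T) (𝓝 (N.capacity e)) := by
    intro e he heS
    by_cases hed : N.head e ∈ N.dests
    · have hbB : (fun k : N.localLinks (Sum.inl e) => b k) = fun k => N.buffer k.1 := by
        ext k
        rcases mem_localLinks.1 k.2 with hk | hk
        · have hk' : N.tail k = N.head e := hk
          exact absurd (hk' ▸ hed) (not_mem_dests_tail _)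
        · have hek : e = k := Sum.inl.inj hk
          exact memJ.1 (hek ▸ he)
      have := hx (Sum.inl e)
      rw [hbB] at this
      exact (f.outflow_tendsto e hed).comp this
    · obtain ⟨hd, hlim⟩ := hφlim _ (hblock e heS hed)
      rw [← f.outflow_of_congested e _ hd (memJ.1 he)]
      exact ENNReal.tendsto_coe.2 (tendsto_finsetSum _ fun j _ => hlim j)
  -- the sources that see a link that is not congested; their flows have limits
  set Bd : Finset N.Source := Finset.univ.filter fun i => ∃ k ∈ N.localLinks i, k ∉ J with hBd
  have memBd : ∀ {i}, i ∈ Bd ↔ ∃ k ∈ N.localLinks i, k ∉ J := by simp [hBd]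
  -- a bound for the flow to congested links from the other sources
  set m : N.Source → ℝ → ℝ≥0 := fun i t => Sum.elim
    (fun e => if e ∈ J ∧ N.head e ∈ S then o e t else 0)
    (fun v : N.origins => if v.1 ∈ S then N.inflow v else 0) i with hm
  have hgm : ∀ t ∈ timeInterval T, ∀ i, g i t ≤ (if i ∈ Bd then g i t else 0) + m i t := by
    intro t ht i
    have hd := ofReal_mem_localDomain (localDensity_mem (i := i) (h.2 t ht).1)
    have hgo : g i t ≤ ∑ j, φ i t j := by
      rw [Fintype.sum_sum_type]
      exact (Finset.sum_le_sum_of_subset (Finset.subset_univ J)).trans le_self_add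
    by_cases hi : i ∈ Bd
    · rw [if_pos hi]; exact le_self_add
    rw [if_neg hi, zero_add]
    rcases i with e | v
    · have heJ : e ∈ J := by
        by_contra heJ
        exact hi (memBd.2 ⟨e, (N.self e).2, heJ⟩)
      by_cases heS : N.head e ∈ S
      · simp only [hm, Sum.elim_inl, if_pos (And.intro heJ heS)]
        exact hgo
      · have hed : N.head e ∈ N.dests := by
          by_contra hed
          exact hi (memBd.2 (hblock e heS hed))
        have : g (Sum.inl e) t = 0 := Finset.sum_eq_zero fun k _ =>
          f.flow_eq_zero _ _ hd _ fun hk => by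
            have hk' : N.tail k = N.head e := hk
            exact absurd (hk' ▸ hed) (not_mem_dests_tail _)
        rw [this]
        exact zero_le
    · have hvS : v.1 ∈ S := by
        refine memS.2 ⟨not_mem_dests_of_mem_origins v.2, fun e he => ?_⟩
        by_contra heb
        exact hi (memBd.2 ⟨e, mem_localLinks.2 (Or.inl he), fun heJ => heb (memJ.1 heJ)⟩)
      simp only [hm, Sum.elim_inr, if_pos hvS]
      exact hgo.trans (f.outflow_origin v _ hd).le
  -- the rate of change of the total density of the congested links
  have hdrift : ∀ t ∈ timeInterval T, ∑ e ∈ J, f.drift (ρ t) e ≤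
      ((∑ i ∈ Bd, g i t + N.cutInflow S : ℝ≥0) : ℝ) -
        ((∑ e ∈ J with N.head e ∉ S, o e t : ℝ≥0) : ℝ) := by
    intro t ht
    have h1 : ∑ e ∈ J, f.drift (ρ t) e =
        ((∑ i, g i t : ℝ≥0) : ℝ) - ((∑ e ∈ J, o e t : ℝ≥0) : ℝ) := by
      simp only [drift, inflowAt_eq_coe, outflowAt_eq_coe]
      rw [Finset.sum_sub_distrib, ← NNReal.coe_sum, ← NNReal.coe_sum, Finset.sum_comm]
    have h2 : ∑ i, g i t ≤ ∑ i ∈ Bd, g i t + ∑ i, m i t := by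
      refine (Finset.sum_le_sum fun i _ => hgm t ht i).trans (le_of_eq ?_)
      rw [Finset.sum_add_distrib, Finset.sum_ite_mem, Finset.univ_inter]
    have h3 : ∑ i, m i t = ∑ e ∈ J with N.head e ∈ S, o e t + N.cutInflow S := by
      rw [Fintype.sum_sum_type]
      congr 1
      · simp only [hm, Sum.elim_inl]
        rw [← Finset.sum_filter]
        congr 1
        ext e
        simp
      · have := sum_origins (N := N) S
        rw [← NNReal.coe_inj, ← this]
        simp only [hm, Sum.elim_inr]
        push_cast
        exact Finset.sum_congr rfl fun v _ => by split_ifs <;> rfl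
    have h4 := Finset.sum_filter_add_sum_filter_not J (fun e => N.head e ∈ S) fun e => o e t
    rw [h1, ← h4]
    rw [h3] at h2
    have h2' := NNReal.coe_le_coe.2 h2
    push_cast at h2' ⊢
    linarith
  have hcap : ∑ e ∈ J with N.head e ∉ S, N.capacity e ≤ N.cutInflow S := by
    by_contra! hlt
    have hP : Tendsto (fun t => ((∑ i ∈ Bd, g i t + N.cutInflow S : ℝ≥0) : ℝ≥0∞)) (endFilter T)
        (𝓝 (N.cutInflow S)) := by
      rw [ENNReal.tendsto_coe]
      have : Tendsto (fun t => ∑ i ∈ Bd, g i t) (endFilter T) (𝓝 (∑ i ∈ Bd, 0)) :=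
        tendsto_finsetSum _ fun i hi => hglim i (memBd.1 hi)
      simpa using this.add_const (N.cutInflow S)
    have hQ : Tendsto (fun t => ((∑ e ∈ J with N.head e ∉ S, o e t : ℝ≥0) : ℝ≥0∞)) (endFilter T)
        (𝓝 (∑ e ∈ J with N.head e ∉ S, N.capacity e)) := by
      simp only [ENNReal.ofNNReal_finsetSum]
      refine tendsto_finsetSum _ fun e he => ?_
      rw [Finset.mem_filter] at he
      exact holim e he.1 he.2
    obtain ⟨a, ha, hlt⟩ := (eventually_endFilter hT).1 (hP.eventually_lt hQ hlt)
    have hanti : AntitoneOn (fun t => ∑ e ∈ J, ρ t e) (Ici a ∩ timeInterval T) := by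
      refine antitoneOn_of_hasDerivWithinAt_timeInterval
        (g' := fun t => ∑ e ∈ J, f.drift (ρ t) e)
        (fun t ht => HasDerivWithinAt.fun_sum fun e _ => (h.2 t ht).2 e) fun t ht hat => ?_
      have := NNReal.coe_lt_coe.2 (ENNReal.coe_lt_coe.1 (hlt t ht hat))
      linarith [hdrift t ht]
    have hlim : Tendsto (fun t => ∑ e ∈ J, ENNReal.ofReal (ρ t e)) (endFilter T)
        (𝓝 (∑ e ∈ J, N.buffer e)) := by
      refine tendsto_finsetSum _ fun e he => ?_
      rw [← memJ.1 he]
      exact hb e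
    have hle : ∑ e ∈ J, N.buffer e ≤ ∑ e ∈ J, ENNReal.ofReal (ρ a e) := by
      refine le_of_tendsto hlim ((eventually_endFilter hT).2 ⟨a, ha, fun t ht hat => ?_⟩)
      rw [← ENNReal.ofReal_sum_of_nonneg fun e _ => ((h.2 t ht).1 e).1,
        ← ENNReal.ofReal_sum_of_nonneg fun e _ => ((h.2 a ha).1 e).1]
      exact ENNReal.ofReal_le_ofReal (hanti ⟨self_mem_Ici, ha⟩ ⟨hat, ht⟩ hat)
    refine absurd hle (not_le.2 (ENNReal.sum_lt_sum_of_nonempty ?_ fun e _ =>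
      ((h.2 a ha).1 e).2))
    obtain ⟨e, he⟩ := hJ
    exact ⟨e, memJ.2 he⟩
  refine ⟨S, mem_cuts.2 ⟨?_, ?_⟩, ?_, fun e he => (memS.1 he).2 e rfl⟩
  · by_contra hS
    rw [Finset.not_nonempty_iff_eq_empty] at hS
    obtain ⟨e, he⟩ := hJ
    have h1 : N.capacity e ≤ ∑ e ∈ J with N.head e ∉ S, N.capacity e :=
      Finset.single_le_sum (f := N.capacity) (fun _ _ => zero_le)
        (Finset.mem_filter.2 ⟨memJ.2 he, by simp [hS]⟩)
    have h2 := (N.capacity_pos e).trans_le (h1.trans hcap)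
    rw [hS] at h2
    simp [cutInflow] at h2
  · exact Finset.disjoint_left.2 fun v hv => (memS.1 hv).1
  · refine le_trans (Finset.sum_le_sum_of_subset fun e he => ?_) hcap
    rw [Finset.mem_filter] at he ⊢
    exact ⟨memJ.2 ((memS.1 he.2.1).2 e rfl), he.2.2⟩

/-- If the exit time is finite, then every density has a limit at the exit time, since inflows are
bounded; the limit is not in the state space, as the solution cannot be continued. -/
theorem IsSolution.exists_cut_of_exitTime_ne_top (h₀ : ρ₀ ∈ N.states)
    (h : f.IsSolution ρ₀ (f.exitTime ρ₀) ρ) (htop : f.exitTime ρ₀ ≠ ⊤) :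
    ∃ S ∈ N.cuts, N.cutCapacity S ≤ N.cutInflow S ∧ ∀ e, N.tail e ∈ S →
      Tendsto (fun t => ENNReal.ofReal (ρ t e)) (endFilter (f.exitTime ρ₀)) (𝓝 (N.buffer e)) := by
  have hpos := exitTime_pos f h₀
  set T := f.exitTime ρ₀ with hTdef
  obtain ⟨K, hK, hin⟩ := exists_inflowAt_le f
  have hlim : ∀ e, ∃ l, Tendsto (fun t => ρ t e) (endFilter T) (𝓝 l) := by
    intro e
    have hanti : AntitoneOn (fun t => ρ t e - K * t) (timeInterval T) := by
      have := antitoneOn_of_hasDerivWithinAt_timeInterval (a := 0) (T := T)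
        (g := fun t => ρ t e - K * t) (g' := fun t => f.drift (ρ t) e - K * 1)
        (fun t ht => ((h.2 t ht).2 e).sub ((hasDerivWithinAt_id t _).const_mul K))
        fun t ht _ => by
          have h1 := hin _ (h.2 t ht).1 e
          have h2 := outflowAt_nonneg (f := f) (ρ t) e
          simp only [drift]
          linarith
      exact this.mono fun t ht => ⟨ht.1, ht⟩
    have hbdd : BddBelow ((fun t => ρ t e - K * t) '' timeInterval T) := by
      refine ⟨-(K * T.toReal), ?_⟩
      rintro _ ⟨t, ht, rfl⟩
      have h1 := ((h.2 t ht).1 e).1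
      have h2 : t ≤ T.toReal := (ENNReal.ofReal_le_iff_le_toReal htop).1 ht.2.le
      have h3 := mul_le_mul_of_nonneg_left h2 hK.le
      simp only
      linarith
    have hne : ((fun t => ρ t e - K * t) '' timeInterval T).Nonempty :=
      ⟨_, 0, ⟨le_rfl, by simpa using hpos⟩, rfl⟩
    have h1 := tendsto_endFilter_of_antitoneOn hpos hanti (isGLB_csInf hne hbdd)
    have h2 : Tendsto (fun t => K * t) (endFilter T) (𝓝 (K * T.toReal)) := by
      have hTr : 0 < T.toReal := ENNReal.toReal_pos hpos.ne' htop
      rw [← ENNReal.ofReal_toReal htop, endFilter_ofReal hTr, ENNReal.toReal_ofReal hTr.le]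
      exact (continuous_const.mul continuous_id).continuousWithinAt
    exact ⟨_, (h1.add h2).congr fun t => by ring⟩
  choose p hp using hlim
  have := endFilter_neBot hpos
  have hp' : ∀ e, Tendsto (fun t => ENNReal.ofReal (ρ t e)) (endFilter T)
      (𝓝 (ENNReal.ofReal (p e))) := fun e => ENNReal.tendsto_ofReal (hp e)
  have hp0 : ∀ e, 0 ≤ p e := fun e => ge_of_tendsto (hp e) <| by
    filter_upwards [eventually_endFilter_mem hpos] with t ht using ((h.2 t ht).1 e).1
  have hpB : ∀ e, ENNReal.ofReal (p e) ≤ N.buffer e := fun e => le_of_tendsto (hp' e) <| by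
    filter_upwards [eventually_endFilter_mem hpos] with t ht using ((h.2 t ht).1 e).2.le
  have hJ : ∃ e, ENNReal.ofReal (p e) = N.buffer e := by
    by_contra! hne
    have hps : p ∈ N.states := fun e => ⟨hp0 e, lt_of_le_of_ne (hpB e) (hne e)⟩
    have hTr : 0 < T.toReal := ENNReal.toReal_pos hpos.ne' htop
    have h' := h
    rw [← ENNReal.ofReal_toReal htop] at h' hp
    rw [endFilter_ofReal hTr] at hp
    obtain ⟨T', hT', ρ', hρ'⟩ := h'.exists_extension hTr hps (tendsto_pi_nhds.2 hp)
    have h1 : ENNReal.ofReal T' ≤ T := le_sSup ⟨ρ', hρ'⟩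
    have h2 := (ENNReal.ofReal_le_iff_le_toReal htop).1 h1
    linarith
  obtain ⟨S, hS, hcap, hfull⟩ := h.exists_cut hpos hp' hJ
  exact ⟨S, hS, hcap, fun e he => hfull e he ▸ hp' e⟩

end RoutingPolicy

end FlowNetwork

/-! ### Asymptotics of differentiable functions -/

theorem eq_zero_of_tendsto_of_tendsto_deriv {g g' : ℝ → ℝ} {l c : ℝ}
    (hg : ∀ t > 0, HasDerivAt g (g' t) t) (hl : Tendsto g atTop (𝓝 l))
    (hc : Tendsto g' atTop (𝓝 c)) : c = 0 := by
  have : ∀ t : ℝ, ∃ ξ, t ≤ ξ ∧ (0 < t → g' ξ = g (t + 1) - g t) := by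
    intro t
    by_cases ht : 0 < t
    · obtain ⟨ξ, hξ, h⟩ := exists_hasDerivAt_eq_slope g g' (lt_add_one t)
        (fun s hs => (hg s (ht.trans_le hs.1)).continuousAt.continuousWithinAt)
        (fun s hs => hg s (ht.trans hs.1))
      exact ⟨ξ, hξ.1.le, fun _ => by simpa using h⟩
    · exact ⟨t, le_rfl, fun h => absurd h ht⟩
  choose ξ hξ hslope using this
  have h1 : Tendsto (fun t => g' (ξ t)) atTop (𝓝 c) := hc.comp (tendsto_atTop_mono hξ tendsto_id)
  have h2 : Tendsto (fun t => g (t + 1) - g t) atTop (𝓝 (l - l)) :=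
    (hl.comp (tendsto_atTop_add_const_right _ 1 tendsto_id)).sub hl
  rw [sub_self] at h2
  refine tendsto_nhds_unique h1 (h2.congr' ?_)
  filter_upwards [eventually_gt_atTop 0] with t ht using (hslope t ht).symm

/-- A one-sided form of Barbalat's lemma. If `w` converges and decreases at rate at least `η` while
`u ≥ δ`, and `u` increases at rate at most `K`, then eventually `u < 2 * δ`: each time at which
`u ≥ 2 * δ` ends an interval of length `δ / K` on which `u ≥ δ`. -/
theorem eventually_lt_two_mul {u w w' : ℝ → ℝ} {K δ η l a : ℝ} (hK : 0 < K) (hδ : 0 < δ)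
    (hη : 0 < η) (hu : AntitoneOn (fun t => u t - K * t) (Ici a)) (hw : Tendsto w atTop (𝓝 l))
    (hw' : ∀ t ≥ a, HasDerivAt w (w' t) t) (h : ∀ t ≥ a, δ ≤ u t → w' t ≤ -η) :
    ∀ᶠ t in atTop, u t < 2 * δ := by
  have hτ : 0 < δ / K := div_pos hδ hK
  have h1 : Tendsto (fun t => w (t - δ / K) - w t) atTop (𝓝 (l - l)) :=
    (hw.comp (tendsto_atTop_add_const_right _ (-(δ / K)) tendsto_id)).sub hw
  rw [sub_self] at h1
  filter_upwards [h1.eventually_lt_const (mul_pos hη hτ), eventually_ge_atTop (a + δ / K)]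
    with t ht hta
  by_contra! hut
  have hge : ∀ s ∈ Icc (t - δ / K) t, a ≤ s ∧ δ ≤ u s := by
    intro s hs
    have has : a ≤ s := by linarith [hs.1]
    refine ⟨has, ?_⟩
    have h2 := hu (mem_Ici.2 has) (mem_Ici.2 (has.trans hs.2)) hs.2
    have h3 : K * (t - s) ≤ δ := by
      have := mul_le_mul_of_nonneg_left (by linarith [hs.1] : t - s ≤ δ / K) hK.le
      rwa [mul_div_cancel₀ _ hK.ne'] at this
    simp only at h2
    linarith
  have hanti : AntitoneOn (fun s => w s + η * s) (Icc (t - δ / K) t) := by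
    refine antitoneOn_of_hasDerivWithinAt_nonpos (f' := fun s => w' s + η * 1) (convex_Icc _ _) ?_
      ?_ ?_
    · intro s hs
      exact ((hw' s (hge s hs).1).continuousAt.add
        (continuousAt_const.mul continuousAt_id)).continuousWithinAt
    · intro s hs
      exact ((hw' s (hge s (interior_subset hs)).1).add
        ((hasDerivAt_id s).const_mul η)).hasDerivWithinAt
    · intro s hs
      obtain ⟨h2, h3⟩ := hge s (interior_subset hs)
      linarith [h s h2 h3]
  have := hanti (left_mem_Icc.2 (by linarith)) (right_mem_Icc.2 (by linarith)) (by linarith)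
  simp only at this
  have h4 : η * (t - δ / K) = η * t - η * (δ / K) := by ring
  linarith

namespace FlowNetwork

variable {V E : Type*} [Fintype V] [DecidableEq V] [Fintype E] [DecidableEq E]
  {N : FlowNetwork V E}

/-! ### Cuts and the excess inflow -/

theorem cutInflow_lt_of_maxExcess_neg (h : N.maxExcess < 0) {U : Finset V} (hU : U ∈ N.cuts) :
    (N.cutInflow U : ℝ≥0∞) < N.cutCapacity U := by
  have h1 := (Finset.sup_lt_iff EReal.bot_lt_zero).1 h U hU
  rw [← EReal.coe_ennreal_lt_coe_ennreal_iff]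
  by_contra! hle
  refine absurd h1 (not_lt.2 ?_)
  exact EReal.sub_nonneg (by simp) (by simp) |>.2 hle

theorem exists_lt_cutInflow_of_maxExcess_pos (h : 0 < N.maxExcess) :
    ∃ U ∈ N.cuts, N.cutCapacity U < N.cutInflow U := by
  obtain ⟨U, hU, h1⟩ := Finset.lt_sup_iff.1 h
  refine ⟨U, hU, ?_⟩
  rw [← EReal.coe_ennreal_lt_coe_ennreal_iff]
  exact EReal.sub_pos.1 h1

theorem exists_le_cutInflow_of_maxExcess_eq_zero (h : N.maxExcess = 0) :
    ∃ U ∈ N.cuts, N.cutCapacity U ≤ N.cutInflow U := by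
  obtain ⟨U, hU, h1⟩ := (Finset.le_sup_iff EReal.bot_lt_zero).1 h.ge
  refine ⟨U, hU, ?_⟩
  rw [← EReal.coe_ennreal_le_coe_ennreal_iff]
  exact EReal.sub_nonneg (by simp) (by simp) |>.1 h1

/-- Every cut is left by some link, since the external world can be reached from it. -/
theorem Connected.exists_leaving (hN : N.Connected) {U : Finset V} (hU : U ∈ N.cuts) :
    ∃ e, N.tail e ∈ U ∧ N.head e ∉ U := by
  obtain ⟨⟨u, hu⟩, hd⟩ := mem_cuts.1 hU
  by_contra! h
  have key : ∀ y, Relation.ReflTransGen N.AugAdj (some u) y → ∃ v ∈ U, y = some v := by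
    intro y hy
    induction hy with
    | refl => exact ⟨u, hu, rfl⟩
    | tail _ hstep ih =>
      obtain ⟨v, hv, rfl⟩ := ih
      cases hstep with
      | link e => exact ⟨_, h e hv, rfl⟩
      | exit _ hvd => exact absurd hvd (Finset.disjoint_left.1 hd hv)
  obtain ⟨v, _, hv⟩ := key none (hN.2 _ _)
  cases hv

theorem zero_mem_states : (0 : E → ℝ) ∈ N.states := fun e => by
  simpa using N.buffer_pos e

theorem localDensity_update {i : N.Source} (ρ : E → ℝ) (k : N.localLinks i) (s : ℝ) :
    localDensity i (Function.update ρ k s) = Function.update (localDensity i ρ) k s := by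
  ext l
  by_cases h : l = k
  · subst h; simp [localDensity]
  · have : l.1 ≠ k.1 := fun h' => h (Subtype.ext h')
    simp [localDensity, h, this]

namespace RoutingPolicy

variable {f : N.RoutingPolicy} {ρ₀ : E → ℝ} {T : ℝ≥0∞} {ρ : ℝ → E → ℝ} {p : E → ℝ}

theorem IsEquilibrium.drift_eq_zero (hp : f.IsEquilibrium p) (e : E) : f.drift p e = 0 :=
  sub_eq_zero.2 (hp.2 e)

/-! ### Equilibria of strongly monotone policies -/

/-- At an equilibrium of a strongly monotone policy, if the source `i` has a positive density, then
so has every link downstream of `i`. The empty links downstream of `i` receive no flow. By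
monotonicity this remains true when their densities are raised to positive values, which contradicts
strong monotonicity in the interior of the box. -/
theorem IsStronglyMonotone.pos_of_downstream (hf : f.IsStronglyMonotone) (hp : f.IsEquilibrium p)
    {i : N.Source} (hi : ∀ e, i = Sum.inl e → 0 < p e) {k : E} (hk : N.tail k = N.sourceHead i) :
    0 < p k := by
  by_contra! hk0'
  have hk0 : p k = 0 := le_antisymm hk0' (hp.1 k).1
  have : ∀ e, ∃ c : ℝ, 0 < c ∧ ENNReal.ofReal c < N.buffer e := fun e => by
    obtain ⟨r, hr, hr'⟩ := ENNReal.lt_iff_exists_nnreal_btwn.1 (N.buffer_pos e)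
    exact ⟨r, by simpa using hr, by simpa using hr'⟩
  choose c hc0 hcB using this
  set x := localDensity i p with hx
  have hxB : x ∈ N.localBox i := localDensity_mem hp.1
  set x' : N.localLinks i → ℝ := fun l => if p l = 0 then c l else p l with hx'
  have hx'B : x' ∈ N.localBox i := fun l => by
    by_cases h : p l = 0
    · simpa [hx', h] using ⟨(hc0 l).le, hcB l⟩
    · simpa [hx', h] using hp.1 l
  have hx'pos : ∀ l, 0 < x' l := fun l => by
    by_cases h : p l = 0
    · simpa [hx', h] using hc0 l
    · simpa [hx', h] using lt_of_le_of_ne (hp.1 l).1 (Ne.symm h)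
  have hxx' : x ≤ x' := fun l => by
    by_cases h : p l = 0
    · simpa [hx, localDensity, hx', h] using (hc0 l).le
    · simp [hx, localDensity, hx', h]
  have hzero : ∀ l, p l = 0 → f.realFlow i (Sum.inl l) x = 0 := by
    intro l hl
    have h1 : f.inflowAt p l = 0 := by rw [hp.2 l, outflowAt_of_eq_zero hp.1 hl]
    rw [inflowAt_eq] at h1
    exact (Finset.sum_eq_zero_iff_of_nonneg fun i _ => realFlow_nonneg i _ _).1 h1 i
      (Finset.mem_univ i)
  have hle : ∀ j ∈ (Finset.univ : Finset N.Target), f.realFlow i j x ≤ f.realFlow i j x' := by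
    intro j _
    by_cases hj : ∃ l, j = Sum.inl l ∧ p l = 0
    · obtain ⟨l, rfl, hl⟩ := hj
      rw [hzero l hl]
      exact realFlow_nonneg _ _ _
    · push Not at hj
      refine hf.1.realFlow_le hxB hx'B hxx' fun l hl => ?_
      simp [hx, localDensity, hx', hj l hl]
  have hout : f.realOutflow i x' ≤ f.realOutflow i x := by
    refine hf.1.realOutflow_le hxB hx'B hxx' fun l hl => ?_
    rcases mem_localLinks.1 l.2 with h | h
    · exact absurd h hl
    · simp [hx, localDensity, hx', (hi l h).ne']
  have heq := (Finset.sum_eq_sum_iff_of_le hle).1 (le_antisymm (Finset.sum_le_sum hle) hout)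
  have hk' : f.realFlow i (Sum.inl k) x' = 0 := by
    rw [← heq _ (Finset.mem_univ _), hzero k hk0]
  by_cases hother : ∃ l : N.localLinks i, l.1 ≠ k
  · obtain ⟨l, hl⟩ := hother
    have hhalf : 0 < x' l / 2 := half_pos (hx'pos l)
    have hhalfB : ENNReal.ofReal (x' l / 2) < N.buffer l :=
      (ENNReal.ofReal_le_ofReal (half_le_self (hx'pos l).le)).trans_lt (hx'B l).2
    have hlt := hf.realFlow_lt (i := i) (j := Sum.inl k) hk
      (x := Function.update x' l (x' l / 2))
      (update_mem_densityBox (β := fun l : N.localLinks i => N.buffer l) hx'B hhalf.le hhalfB)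
      (fun m => by
        by_cases hm : m = l
        · subst hm; simpa using hx'pos m
        · simpa [hm] using hx'pos m)
      (k := l) (fun h => hl (Sum.inl.inj h).symm) (s := x' l)
      (by simpa using hx'pos l) (hx'B l).2
    simp only [Function.update_idem, Function.update_eq_self, hk'] at hlt
    exact absurd hlt (not_lt.2 (realFlow_nonneg _ _ _))
  · push Not at hother
    rcases i with e | v
    · have h1 : e = k := hother (N.self e)
      subst h1
      exact N.head_ne_tail e hk.symm
    · have h1 : f.realOutflow (Sum.inr v) x = 0 := by
        refine Finset.sum_eq_zero fun j _ => ?_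
        by_cases hj : N.targetTail j = N.sourceHead (Sum.inr v)
        · rcases j with l | d
          · have : l = k := hother ⟨l, mem_localLinks.2 (Or.inl hj)⟩
            rw [this, hzero k hk0]
          · have hj' : d.1 = v.1 := hj
            exact absurd (hj' ▸ d.2) (not_mem_dests_of_mem_origins v.2)
        · exact realFlow_eq_zero hj hxB
      rw [realOutflow_origin hxB] at h1
      have : 0 < N.inflow v.1 := by simpa [origins] using v.2
      exact this.ne' (by exact_mod_cast h1)

theorem IsStronglyMonotone.equilibrium_pos (hN : N.Connected) (hf : f.IsStronglyMonotone)
    (hp : f.IsEquilibrium p) (e : E) : 0 < p e := by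
  have key : ∀ y, Relation.ReflTransGen N.AugAdj none y →
      ∀ v, y = some v → ∀ k, N.tail k = v → 0 < p k := by
    intro y hy
    induction hy with
    | refl => intro v hv; cases hv
    | tail _ hstep ih =>
      cases hstep with
      | link l =>
        rintro v hv k hk
        obtain rfl := Option.some.inj hv
        exact hf.pos_of_downstream hp (i := Sum.inl l)
          (fun e he => Sum.inl.inj he ▸ ih _ rfl l rfl) hk
      | entry u hu =>
        rintro v hv k hk
        obtain rfl := Option.some.inj hv
        exact hf.pos_of_downstream hp (i := Sum.inr ⟨u, hu⟩) (fun e he => by cases he) hk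
      | exit u hu => intro v hv; cases hv
  exact key _ (hN.2 none (some (N.tail e))) _ rfl e rfl

theorem IsStronglyMonotone.outflowAt_lt_update (hf : f.IsStronglyMonotone) (hp : p ∈ N.states)
    (hpos : ∀ e, 0 < p e) {e : E} {s : ℝ} (hs : p e < s) (hsB : ENNReal.ofReal s < N.buffer e) :
    f.outflowAt p e < f.outflowAt (Function.update p e s) e := by
  have hB := localDensity_mem (i := Sum.inl e) hp
  have hB' := localDensity_mem (i := Sum.inl e)
    (update_mem_densityBox hp ((hpos e).le.trans hs.le) hsB)
  have hlt : ∀ j, N.targetTail j = N.head e →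
      f.realFlow (Sum.inl e) j (localDensity _ p) <
        f.realFlow (Sum.inl e) j (localDensity _ (Function.update p e s)) := by
    intro j hj
    have := hf.realFlow_lt (i := Sum.inl e) hj hB (fun k => hpos k) (k := N.self e)
      (by rintro rfl; exact N.head_ne_tail e hj.symm) hs hsB
    rwa [← localDensity_update] at this
  rw [outflowAt_eq, outflowAt_eq]
  refine Finset.sum_lt_sum (fun j _ => ?_) ?_
  · by_cases hj : N.targetTail j = N.head e
    · exact (hlt j hj).le
    · rw [realFlow_eq_zero hj hB, realFlow_eq_zero hj hB']
  · by_cases hd : N.head e ∈ N.dests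
    · exact ⟨Sum.inr ⟨_, hd⟩, Finset.mem_univ _, hlt _ rfl⟩
    · obtain ⟨k, hk⟩ := exists_tail_eq hd
      exact ⟨Sum.inl k, Finset.mem_univ _, hlt _ hk⟩

theorem exists_gt_of_mem_states (hp : p ∈ N.states) (e : E) :
    ∃ δ > 0, ENNReal.ofReal (p e + δ) < N.buffer e := by
  obtain ⟨r, hr, hr'⟩ := ENNReal.lt_iff_exists_nnreal_btwn.1 (hp e).2
  rw [ENNReal.ofReal_lt_iff_lt_toReal (hp e).1 ENNReal.coe_ne_top] at hr
  refine ⟨r - p e, sub_pos.2 (by simpa using hr), by simpa using hr'⟩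

theorem IsStronglyMonotone.ofReal_outflowAt_lt (hN : N.Connected) (hf : f.IsStronglyMonotone)
    (hp : f.IsEquilibrium p) (e : E) : ENNReal.ofReal (f.outflowAt p e) < N.capacity e := by
  obtain ⟨δ, hδ, hδB⟩ := exists_gt_of_mem_states hp.1 e
  have hpos := hf.equilibrium_pos hN hp
  have h1 := hf.outflowAt_lt_update hp.1 hpos (lt_add_of_pos_right _ hδ) hδB
  refine lt_of_lt_of_le ?_ (ofReal_outflowAt_le (f := f)
    (update_mem_densityBox hp.1 (add_pos (hpos e) hδ).le hδB) e)
  exact (ENNReal.ofReal_lt_ofReal_iff_of_nonneg (outflowAt_nonneg _ _)).2 h1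

theorem IsEquilibrium.cutInflow_le_cutCapacity (hp : f.IsEquilibrium p) {U : Finset V}
    (hU : U ∈ N.cuts) : N.cutInflow U ≤ N.cutCapacity U := by
  have h1 := hp.cutInflow_le (mem_cuts.1 hU).2
  rw [← ENNReal.ofReal_coe_nnreal]
  refine (ENNReal.ofReal_le_ofReal h1).trans ?_
  rw [ENNReal.ofReal_sum_of_nonneg fun e _ => outflowAt_nonneg _ _]
  exact Finset.sum_le_sum fun e _ => ofReal_outflowAt_le hp.1 e

theorem IsStronglyMonotone.cutInflow_lt_cutCapacity (hN : N.Connected) (hf : f.IsStronglyMonotone)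
    (hp : f.IsEquilibrium p) {U : Finset V} (hU : U ∈ N.cuts) :
    N.cutInflow U < N.cutCapacity U := by
  have h1 := hp.cutInflow_le (mem_cuts.1 hU).2
  rw [← ENNReal.ofReal_coe_nnreal]
  refine (ENNReal.ofReal_le_ofReal h1).trans_lt ?_
  rw [ENNReal.ofReal_sum_of_nonneg fun e _ => outflowAt_nonneg _ _]
  refine ENNReal.sum_lt_sum_of_nonempty ?_ fun e _ => hf.ofReal_outflowAt_lt hN hp e
  obtain ⟨e, he⟩ := hN.exists_leaving hU
  exact ⟨e, by simpa using he⟩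

/-! ### The solution that starts with empty links -/

theorem IsSolution.shift (h : f.IsSolution ρ₀ ⊤ ρ) {s : ℝ} (hs : 0 ≤ s) :
    f.IsSolution (ρ s) ⊤ fun t => ρ (s + t) := by
  refine ⟨by simp, fun t ht => ?_⟩
  have hst : s + t ∈ timeInterval ⊤ := by
    rw [timeInterval_top] at ht ⊢
    exact mem_Ici.2 (add_nonneg hs ht)
  refine ⟨(h.2 _ hst).1, fun e => ?_⟩
  have h1 := (h.2 _ hst).2 e
  have h2 : HasDerivWithinAt (fun r => s + r) 1 (timeInterval ⊤) t :=
    (hasDerivWithinAt_id t _).const_add s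
  have h3 := HasDerivWithinAt.scomp t h1 h2 (fun r hr => by
    rw [timeInterval_top] at hr ⊢
    exact mem_Ici.2 (add_nonneg hs hr))
  rwa [one_smul] at h3

theorem IsSolution.monotoneOn_of_zero (hf : f.IsMonotone) (h : f.IsSolution 0 ⊤ ρ) :
    MonotoneOn ρ (timeInterval ⊤) := by
  intro s hs t ht hst
  rw [timeInterval_top] at hs ht
  have h2 := h.le hf (h.shift (s := t - s) (sub_nonneg.2 hst))
    (fun e => ((h.2 (t - s) (by rw [timeInterval_top]; exact mem_Ici.2 (sub_nonneg.2 hst))).1 e).1)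
    (t := s) (by rwa [timeInterval_top]) (by rwa [timeInterval_top])
  simpa using h2

theorem IsSolution.isEquilibrium_of_tendsto (h : f.IsSolution ρ₀ ⊤ ρ) (hp : p ∈ N.states)
    (hlim : Tendsto ρ atTop (𝓝 p)) : f.IsEquilibrium p := by
  have hmem : ∀ {t : ℝ}, 0 < t → t ∈ timeInterval ⊤ := fun ht => by
    rw [timeInterval_top]; exact mem_Ici.2 ht.le
  refine ⟨hp, fun e => sub_eq_zero.1 ?_⟩
  refine eq_zero_of_tendsto_of_tendsto_deriv (g := fun t => ρ t e) (l := p e)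
    (fun t ht => h.hasDerivAt (hmem ht) ht e) (tendsto_pi_nhds.1 hlim e) ?_
  refine tendsto_pi_nhds.1 ((continuousOn_drift (f := f) p hp).tendsto.comp
    (tendsto_nhdsWithin_iff.2 ⟨hlim, ?_⟩)) e
  filter_upwards [eventually_gt_atTop 0] with t ht using (h.2 t (hmem ht)).1

/-- The solution that starts with empty links is nondecreasing in time. Hence it converges to an
equilibrium, or the links that start in some cut whose inflow is at least its capacity become
congested. -/
theorem IsSolution.exists_equilibrium_or_cut (hf : f.IsMonotone) (h : f.IsSolution 0 ⊤ ρ) :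
    (∃ p, f.IsEquilibrium p ∧ Tendsto ρ atTop (𝓝 p)) ∨
    ∃ S ∈ N.cuts, N.cutCapacity S ≤ N.cutInflow S ∧ ∀ e, N.tail e ∈ S →
      Tendsto (fun t => ENNReal.ofReal (ρ t e)) (endFilter ⊤) (𝓝 (N.buffer e)) := by
  have hmono := h.monotoneOn_of_zero hf
  have hlim : ∀ e, Tendsto (fun t => ENNReal.ofReal (ρ t e)) (endFilter ⊤)
      (𝓝 (sSup ((fun t => ENNReal.ofReal (ρ t e)) '' timeInterval ⊤))) := fun e =>
    tendsto_endFilter_of_monotoneOn ENNReal.zero_lt_top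
      (fun s hs t ht hst => ENNReal.ofReal_le_ofReal (hmono hs ht hst e)) (isLUB_sSup _)
  set b : E → ℝ≥0∞ := fun e => sSup ((fun t => ENNReal.ofReal (ρ t e)) '' timeInterval ⊤)
  by_cases hJ : ∃ e, b e = N.buffer e
  · obtain ⟨S, hS, hcap, hfull⟩ := h.exists_cut ENNReal.zero_lt_top hlim hJ
    exact Or.inr ⟨S, hS, hcap, fun e he => hfull e he ▸ hlim e⟩
  · push Not at hJ
    have hb : ∀ e, b e < N.buffer e := fun e => by
      refine lt_of_le_of_ne (sSup_le ?_) (hJ e)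
      rintro _ ⟨t, ht, rfl⟩
      exact ((h.2 t ht).1 e).2.le
    have hp : (fun e => (b e).toReal) ∈ N.states := fun e =>
      ⟨ENNReal.toReal_nonneg, by rw [ENNReal.ofReal_toReal (hb e).ne_top]; exact hb e⟩
    have hρ : Tendsto ρ atTop (𝓝 fun e => (b e).toReal) := by
      refine tendsto_pi_nhds.2 fun e => ?_
      have h1 := (ENNReal.tendsto_toReal (hb e).ne_top).comp (hlim e)
      rw [endFilter_top] at h1
      refine h1.congr' ?_
      filter_upwards [eventually_ge_atTop 0] with t ht
      exact ENNReal.toReal_ofReal ((h.2 t (by rwa [timeInterval_top])).1 e).1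
    exact Or.inl ⟨_, h.isEquilibrium_of_tendsto hp hρ, hρ⟩

theorem IsEquilibrium.isSolution (hp : f.IsEquilibrium p) (T : ℝ≥0∞) :
    f.IsSolution p T fun _ => p :=
  ⟨rfl, fun t _ => ⟨hp.1, fun e => by
    have := hp.drift_eq_zero e
    rw [drift] at this
    rw [this]
    exact hasDerivWithinAt_const _ _ _⟩⟩

/-! ### Global convergence -/

theorem sum_drift {ρ : E → ℝ} (hρ : ρ ∈ N.states) : ∑ e, f.drift ρ e =
    N.cutInflow (Finset.univ \ N.dests) - ∑ e with N.head e ∈ N.dests, f.outflowAt ρ e := by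
  have h1 := sum_inflowAt_tail_mem (f := f) (U := Finset.univ \ N.dests)
    Finset.sdiff_disjoint hρ
  simp only [Finset.mem_sdiff, Finset.mem_univ, true_and, not_mem_dests_tail, not_false_eq_true,
    Finset.filter_true] at h1
  have h2 := Finset.sum_filter_add_sum_filter_not Finset.univ (fun e => N.head e ∈ N.dests)
    (fun e => f.outflowAt ρ e)
  simp only [drift, Finset.sum_sub_distrib]
  linarith

theorem IsMonotone.outflowAt_le_of_head_mem_dests (hf : f.IsMonotone) {ρ σ : E → ℝ}
    (hρ : ρ ∈ N.states) (hσ : σ ∈ N.states) (h : ρ ≤ σ) {e : E} (he : N.head e ∈ N.dests) :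
    f.outflowAt ρ e ≤ f.outflowAt σ e := by
  rw [outflowAt_eq, outflowAt_eq]
  refine Finset.sum_le_sum fun j _ => ?_
  rcases j with k | d
  · have hk : N.targetTail (Sum.inl k) ≠ N.sourceHead (Sum.inl e) := by
      rintro (hk : N.tail k = N.head e)
      exact not_mem_dests_tail k (hk ▸ he)
    rw [realFlow_eq_zero hk (localDensity_mem hρ), realFlow_eq_zero hk (localDensity_mem hσ)]
  · exact hf.realFlow_le (localDensity_mem hρ) (localDensity_mem hσ) (fun k => h k)
      fun k hk => by cases hk

theorem IsStronglyMonotone.drift_lt_update (hf : f.IsStronglyMonotone) (hp : p ∈ N.states)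
    (hpos : ∀ e, 0 < p e) {i k : E} (hik : N.head i = N.tail k) {s : ℝ} (hs : p i < s)
    (hsB : ENNReal.ofReal s < N.buffer i) :
    f.drift p k < f.drift (Function.update p i s) k := by
  have hne : k ≠ i := by
    rintro rfl
    exact N.head_ne_tail k hik
  have hp' : Function.update p i s ∈ N.states :=
    update_mem_densityBox hp ((hpos i).le.trans hs.le) hsB
  have hle : p ≤ Function.update p i s := by simp [hs.le]
  have heq : p k = Function.update p i s k := by simp [hne]
  have hout := hf.1.outflowAt_le hp hp' hle heq
  suffices f.inflowAt p k < f.inflowAt (Function.update p i s) k by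
    simp only [drift]
    linarith
  rw [inflowAt_eq, inflowAt_eq]
  refine Finset.sum_lt_sum (fun j _ => hf.1.realFlow_localDensity_le hp hp' hle heq j)
    ⟨Sum.inl i, Finset.mem_univ _, ?_⟩
  have := hf.realFlow_lt (i := Sum.inl i) (j := Sum.inl k) hik.symm (localDensity_mem hp)
    (fun k => hpos k) (k := N.self i) (fun h => hne (Sum.inl.inj h)) hs hsB
  rwa [← localDensity_update] at this

/-- Convergence of a component of a solution that lies above `p`, by means of an auxiliary
function `w` that converges and decreases while the component is not close to its limit. -/
theorem IsSolution.tendsto_apply (h : f.IsSolution ρ₀ ⊤ ρ) (hle : ∀ t ≥ 0, p ≤ ρ t)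
    {e : E} {w w' : ℝ → ℝ} {l δ₀ : ℝ} (hw : Tendsto w atTop (𝓝 l))
    (hw' : ∀ t > 0, HasDerivAt w (w' t) t) (hδ₀ : 0 < δ₀)
    (hδ : ∀ δ, 0 < δ → δ ≤ δ₀ → ∃ η > 0, ∀ᶠ t in atTop, p e + δ ≤ ρ t e → w' t ≤ -η) :
    Tendsto (fun t => ρ t e) atTop (𝓝 (p e)) := by
  obtain ⟨K, hK, hin⟩ := exists_inflowAt_le f
  have hmem : ∀ {t : ℝ}, 0 ≤ t → t ∈ timeInterval ⊤ := fun ht => by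
    rw [timeInterval_top]; exact mem_Ici.2 ht
  have hanti : AntitoneOn (fun t => (ρ t e - p e) - K * t) (Ici 0) := by
    have := antitoneOn_of_hasDerivWithinAt_timeInterval (a := 0) (T := ⊤)
      (g := fun t => (ρ t e - p e) - K * t) (g' := fun t => f.drift (ρ t) e - K * 1)
      (fun t ht => (((h.2 t ht).2 e).sub_const (p e)).sub
        ((hasDerivWithinAt_id t _).const_mul K))
      fun t ht _ => by
        have h1 := hin _ (h.2 t ht).1 e
        have h2 := outflowAt_nonneg (f := f) (ρ t) e
        simp only [drift]
        linarith
    exact this.mono fun t ht => ⟨ht, hmem ht⟩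
  refine tendsto_order.2 ⟨fun a ha => ?_, fun a ha => ?_⟩
  · filter_upwards [eventually_ge_atTop 0] with t ht using ha.trans_le (hle t ht e)
  · have hmin : 0 < min δ₀ ((a - p e) / 2) := lt_min hδ₀ (by linarith)
    obtain ⟨η, hη, hev⟩ := hδ _ hmin (min_le_left _ _)
    obtain ⟨c, hc⟩ := eventually_atTop.1 hev
    have := eventually_lt_two_mul (u := fun t => ρ t e - p e) (w' := w') (a := max c 1) hK hmin hη
      (hanti.mono fun t ht => (zero_le_one.trans (le_max_right c 1)).trans ht) hw
      (fun t ht => hw' t (zero_lt_one.trans_le ((le_max_right c 1).trans ht)))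
      (fun t ht hut => hc t ((le_max_left c 1).trans ht) (by linarith))
    filter_upwards [this] with t ht
    have := min_le_right δ₀ ((a - p e) / 2)
    linarith

/-- A solution of a strongly monotone policy that stays above an equilibrium converges to it. The
total density is nonincreasing, which gives the convergence of the links that end in destinations;
and if a link converges, then so do the links upstream of it, since a surplus of density there would
increase its inflow. -/
theorem IsSolution.tendsto_of_equilibrium_le (hN : N.Connected) (hf : f.IsStronglyMonotone)
    (hp : f.IsEquilibrium p) (h : f.IsSolution ρ₀ ⊤ ρ) (hle : ∀ t ≥ 0, p ≤ ρ t) :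
    Tendsto ρ atTop (𝓝 p) := by
  have hpos := hf.equilibrium_pos hN hp
  have hmem : ∀ {t : ℝ}, 0 ≤ t → t ∈ timeInterval ⊤ := fun ht => by
    rw [timeInterval_top]; exact mem_Ici.2 ht
  have hst : ∀ {t : ℝ}, 0 ≤ t → ρ t ∈ N.states := fun ht => (h.2 _ (hmem ht)).1
  have hup : ∀ (e : E) {δ : ℝ}, 0 < δ → ENNReal.ofReal (p e + δ) < N.buffer e →
      Function.update p e (p e + δ) ∈ N.states := fun e δ hδ hB =>
    update_mem_densityBox hp.1 (add_pos (hpos e) hδ).le hB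
  have hdest : ∀ e, N.head e ∈ N.dests → Tendsto (fun t => ρ t e) atTop (𝓝 (p e)) := by
    intro e he
    obtain ⟨δ₀, hδ₀, hB⟩ := exists_gt_of_mem_states hp.1 e
    -- the outflows to destinations balance the inflow at `p`, and they are larger above `p`
    have hdrift : ∀ t ≥ 0, ∑ e, f.drift (ρ t) e =
        -∑ e with N.head e ∈ N.dests, (f.outflowAt (ρ t) e - f.outflowAt p e) := by
      intro t ht
      have h1 := sum_drift (f := f) hp.1
      rw [Finset.sum_eq_zero fun e _ => hp.drift_eq_zero e] at h1
      rw [sum_drift (hst ht), Finset.sum_sub_distrib]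
      linarith
    have hterm : ∀ t ≥ 0, ∀ e ∈ Finset.univ.filter fun e => N.head e ∈ N.dests,
        0 ≤ f.outflowAt (ρ t) e - f.outflowAt p e := fun t ht e he =>
      sub_nonneg.2 (hf.1.outflowAt_le_of_head_mem_dests hp.1 (hst ht) (hle t ht)
        (Finset.mem_filter.1 he).2)
    have hanti : AntitoneOn (fun t => ∑ e, ρ t e) (timeInterval ⊤) := by
      have := antitoneOn_of_hasDerivWithinAt_timeInterval (a := 0) (T := ⊤)
        (g := fun t => ∑ e, ρ t e) (g' := fun t => ∑ e, f.drift (ρ t) e)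
        (fun t ht => HasDerivWithinAt.fun_sum fun e _ => (h.2 t ht).2 e)
        fun t _ ht => by
          rw [hdrift t ht]
          exact neg_nonpos.2 (Finset.sum_nonneg (hterm t ht))
      exact this.mono fun t ht => ⟨ht.1, ht⟩
    have hbdd : BddBelow ((fun t => ∑ e, ρ t e) '' timeInterval ⊤) := by
      refine ⟨0, ?_⟩
      rintro _ ⟨t, ht, rfl⟩
      exact Finset.sum_nonneg fun e _ => ((h.2 t ht).1 e).1
    have hne : ((fun t => ∑ e, ρ t e) '' timeInterval ⊤).Nonempty := ⟨_, 0, hmem le_rfl, rfl⟩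
    have hw := tendsto_endFilter_of_antitoneOn ENNReal.zero_lt_top hanti (isGLB_csInf hne hbdd)
    rw [endFilter_top] at hw
    refine h.tendsto_apply hle hw (fun t ht => HasDerivAt.fun_sum fun e _ =>
      h.hasDerivAt (hmem ht.le) ht e) hδ₀ fun δ hδ hδδ₀ => ?_
    have hδB : ENNReal.ofReal (p e + δ) < N.buffer e :=
      (ENNReal.ofReal_le_ofReal (by linarith)).trans_lt hB
    refine ⟨_, sub_pos.2 (hf.outflowAt_lt_update hp.1 hpos (lt_add_of_pos_right _ hδ) hδB), ?_⟩
    filter_upwards [eventually_ge_atTop 0] with t ht hδt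
    rw [hdrift t ht, neg_le_neg_iff]
    refine le_trans (sub_le_sub_right (hf.1.outflowAt_le_of_head_mem_dests (hup e hδ hδB)
      (hst ht) ?_ he) _) (Finset.single_le_sum (hterm t ht) (by simpa using he))
    exact update_le_iff.2 ⟨hδt, fun j _ => hle t ht j⟩
  have hprop : ∀ k, Tendsto (fun t => ρ t k) atTop (𝓝 (p k)) → ∀ i, N.head i = N.tail k →
      Tendsto (fun t => ρ t i) atTop (𝓝 (p i)) := by
    intro k hk i hik
    have hne : k ≠ i := by
      rintro rfl
      exact N.head_ne_tail k hik
    obtain ⟨δ₀, hδ₀, hB⟩ := exists_gt_of_mem_states hp.1 i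
    refine h.tendsto_apply hle hk.neg (fun t ht => (h.hasDerivAt (hmem ht.le) ht k).neg) hδ₀
      fun δ hδ hδδ₀ => ?_
    have hδB : ENNReal.ofReal (p i + δ) < N.buffer i :=
      (ENNReal.ofReal_le_ofReal (by linarith)).trans_lt hB
    -- as `ρ t k` tends to `p k`, the drift of `k` along the solution is eventually bounded below by
    -- about its drift at `q`, where only the density of `i` has been raised
    set q := Function.update p i (p i + δ) with hq
    have hqs : q ∈ N.states := hup i hδ hδB
    have hqpos : 0 < f.drift q k := by
      have := hf.drift_lt_update hp.1 hpos hik (lt_add_of_pos_right _ hδ) hδB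
      rwa [hp.drift_eq_zero] at this
    have hqk : q k = p k := by simp [hq, hne]
    have hrs : ∀ t ≥ 0, Function.update q k (ρ t k) ∈ N.states := fun t ht =>
      update_mem_densityBox hqs (hst ht k).1 (hst ht k).2
    have hr : Tendsto (fun t => Function.update q k (ρ t k)) atTop (𝓝[N.states] q) := by
      refine tendsto_nhdsWithin_iff.2 ⟨?_, ?_⟩
      · have := (continuous_const.update (f := fun _ : ℝ => q) k continuous_id).tendsto (p k)
        have h2 : Tendsto (fun t => Function.update q k (ρ t k)) atTop
            (𝓝 (Function.update q k (p k))) := this.comp hk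
        rwa [← hqk, Function.update_eq_self] at h2
      · filter_upwards [eventually_ge_atTop 0] with t ht using hrs t ht
    have hd := tendsto_pi_nhds.1 ((continuousOn_drift (f := f) q hqs).tendsto.comp hr) k
    refine ⟨f.drift q k / 2, half_pos hqpos, ?_⟩
    filter_upwards [hd.eventually_const_lt (half_lt_self hqpos), eventually_ge_atTop 0]
      with t hdt ht hδt
    have hqle : q ≤ ρ t := update_le_iff.2 ⟨hδt, fun j _ => hle t ht j⟩
    have := hf.1.drift_le (hrs t ht) (hst ht) (update_le_iff.2 ⟨le_rfl, fun j _ => hqle j⟩)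
      (e := k) (by simp)
    simp only [Function.comp] at hdt
    linarith
  have key : ∀ y, Relation.ReflTransGen N.AugAdj y none → ∀ v, y = some v → ∀ e, N.head e = v →
      Tendsto (fun t => ρ t e) atTop (𝓝 (p e)) := by
    intro y hy
    induction hy using Relation.ReflTransGen.head_induction_on with
    | refl => intro v hv; cases hv
    | head hstep _ ih =>
      cases hstep with
      | link k =>
        rintro v hv e rfl
        exact hprop k (ih _ rfl k rfl) e (Option.some.inj hv).symm
      | entry u hu => intro v hv; cases hv
      | exit u hu =>
        rintro v hv e rfl
        exact hdest e (Option.some.inj hv ▸ hu)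
  exact tendsto_pi_nhds.2 fun e => key _ (hN.2 (some (N.head e)) none) _ rfl e rfl

end RoutingPolicy

end FlowNetwork

namespace FlowNetwork

variable {V E : Type*} [Fintype V] [DecidableEq V] [Fintype E] [DecidableEq E]
  {N : FlowNetwork V E}

namespace RoutingPolicy

variable {f : N.RoutingPolicy} {ρ₀ : E → ℝ} {T : ℝ≥0∞} {ρ : ℝ → E → ℝ}

/-! ### Underload and overload -/

theorem exitTime_eq_top_of_maxExcess_neg (hf : f.IsMonotone) (hneg : N.maxExcess < 0)
    (h₀ : ρ₀ ∈ N.states) : f.exitTime ρ₀ = ⊤ := by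
  by_contra htop
  obtain ⟨ρ, hρ⟩ := exists_isSolution_exitTime hf ρ₀
  obtain ⟨S, hS, hcap, _⟩ := hρ.exists_cut_of_exitTime_ne_top h₀ htop
  exact (cutInflow_lt_of_maxExcess_neg hneg hS).not_ge hcap

/-- The equilibrium is the limit `p` of the solution from empty links. Any other solution lies
between this solution and the one that starts from the supremum of its initial density and `p`. -/
theorem IsStronglyMonotone.exists_equilibrium_of_maxExcess_neg (hN : N.Connected)
    (hf : f.IsStronglyMonotone) (hneg : N.maxExcess < 0) :
    ∃ p, f.IsEquilibrium p ∧ ∀ ρ₀ ∈ N.states, ∀ ρ, f.IsSolution ρ₀ (f.exitTime ρ₀) ρ →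
      Tendsto ρ atTop (𝓝 p) := by
  have htop : ∀ σ ∈ N.states, f.exitTime σ = ⊤ := fun σ hσ =>
    exitTime_eq_top_of_maxExcess_neg hf.1 hneg hσ
  obtain ⟨x, hx⟩ := exists_isSolution_exitTime hf.1 0
  rw [htop 0 zero_mem_states] at hx
  rcases hx.exists_equilibrium_or_cut hf.1 with ⟨p, hp, hxp⟩ | ⟨S, hS, hcap, _⟩
  · refine ⟨p, hp, fun ρ₀ h₀ ρ hρ => ?_⟩
    rw [htop ρ₀ h₀] at hρ
    have hz₀ : ρ₀ ⊔ p ∈ N.states := sup_mem_densityBox h₀ hp.1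
    obtain ⟨z, hz⟩ := exists_isSolution_exitTime hf.1 (ρ₀ ⊔ p)
    rw [htop _ hz₀] at hz
    have hmem : ∀ {t : ℝ}, 0 ≤ t → t ∈ timeInterval ⊤ := fun ht => by
      rw [timeInterval_top]; exact mem_Ici.2 ht
    have hzp := hz.tendsto_of_equilibrium_le hN hf hp fun t ht =>
      (hp.isSolution ⊤).le hf.1 hz le_sup_right (hmem ht) (hmem ht)
    refine tendsto_pi_nhds.2 fun e => tendsto_of_tendsto_of_tendsto_of_le_of_le'
      (tendsto_pi_nhds.1 hxp e) (tendsto_pi_nhds.1 hzp e) ?_ ?_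
    · filter_upwards [eventually_ge_atTop 0] with t ht
      exact hx.le hf.1 hρ (fun e => (h₀ e).1) (hmem ht) (hmem ht) e
    · filter_upwards [eventually_ge_atTop 0] with t ht
      exact hρ.le hf.1 hz le_sup_left (hmem ht) (hmem ht) e
  · exact absurd hcap (cutInflow_lt_of_maxExcess_neg hneg hS).not_ge

theorem not_isEquilibrium_of_overload (hN : N.Connected)
    (h : 0 < N.maxExcess ∨ (N.maxExcess = 0 ∧ f.IsStronglyMonotone)) (p : E → ℝ) :
    ¬ f.IsEquilibrium p := by
  intro hp
  rcases h with h | ⟨h, hf⟩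
  · obtain ⟨U, hU, hlt⟩ := exists_lt_cutInflow_of_maxExcess_pos h
    exact hlt.not_ge (hp.cutInflow_le_cutCapacity hU)
  · obtain ⟨U, hU, hle⟩ := exists_le_cutInflow_of_maxExcess_eq_zero h
    exact (hf.cutInflow_lt_cutCapacity hN hp hU).not_ge hle

/-- The solution from empty links exists for as long as any other solution, since it lies below. -/
theorem exitTime_zero_eq_top (hf : f.IsMonotone) (h₀ : ρ₀ ∈ N.states)
    (htop : f.exitTime ρ₀ = ⊤) : f.exitTime 0 = ⊤ := by
  by_contra hne
  have hpos := exitTime_pos f (zero_mem_states (N := N))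
  obtain ⟨x, hx⟩ := exists_isSolution_exitTime hf 0
  obtain ⟨y, hy⟩ := exists_isSolution_exitTime hf ρ₀
  rw [htop] at hy
  obtain ⟨S, hS, _, hlim⟩ := hx.exists_cut_of_exitTime_ne_top zero_mem_states hne
  obtain ⟨⟨v, hv⟩, hd⟩ := mem_cuts.1 hS
  obtain ⟨e, rfl⟩ := exists_tail_eq (Finset.disjoint_left.1 hd hv)
  have hmem : ∀ {t : ℝ}, 0 ≤ t → t ∈ timeInterval ⊤ := fun ht => by
    rw [timeInterval_top]; exact mem_Ici.2 ht
  set r := (f.exitTime 0).toReal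
  have hr : 0 < r := ENNReal.toReal_pos hpos.ne' hne
  have hyr := (hy.hasDerivAt (hmem hr.le) hr e).continuousAt.tendsto
  have hy' : Tendsto (fun t => ENNReal.ofReal (y t e)) (endFilter (f.exitTime 0))
      (𝓝 (ENNReal.ofReal (y r e))) := by
    rw [← ENNReal.ofReal_toReal hne, endFilter_ofReal hr]
    exact (ENNReal.tendsto_ofReal hyr).mono_left nhdsWithin_le_nhds
  have := endFilter_neBot hpos
  refine ((hy.2 r (hmem hr.le)).1 e).2.not_ge (le_of_tendsto_of_tendsto (hlim e hv) hy' ?_)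
  filter_upwards [eventually_endFilter_mem hpos] with t ht
  exact ENNReal.ofReal_le_ofReal (hx.le hf hy (fun e => (h₀ e).1) ht (hmem ht.1) e)

theorem exists_congested_cut_of_overload (hN : N.Connected) (hf : f.IsMonotone)
    (h : 0 < N.maxExcess ∨ (N.maxExcess = 0 ∧ f.IsStronglyMonotone)) (h₀ : ρ₀ ∈ N.states) :
    ∃ S ∈ N.cuts, ∀ ρ, f.IsSolution ρ₀ (f.exitTime ρ₀) ρ → ∀ e, N.tail e ∈ S →
      Tendsto (fun t => ENNReal.ofReal (ρ t e)) (endFilter (f.exitTime ρ₀))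
        (𝓝 (N.buffer e)) := by
  by_cases htop : f.exitTime ρ₀ = ⊤
  · obtain ⟨x, hx⟩ := exists_isSolution_exitTime hf 0
    rw [exitTime_zero_eq_top hf h₀ htop] at hx
    rcases hx.exists_equilibrium_or_cut hf with ⟨p, hp, _⟩ | ⟨S, hS, _, hlim⟩
    · exact absurd hp (not_isEquilibrium_of_overload hN h p)
    · refine ⟨S, hS, fun ρ hρ e he => ?_⟩
      rw [htop] at hρ ⊢
      refine tendsto_of_tendsto_of_tendsto_of_le_of_le' (hlim e he) tendsto_const_nhds ?_ ?_
      · filter_upwards [eventually_endFilter_mem ENNReal.zero_lt_top] with t ht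
        exact ENNReal.ofReal_le_ofReal (hx.le hf hρ (fun e => (h₀ e).1) ht ht e)
      · filter_upwards [eventually_endFilter_mem ENNReal.zero_lt_top] with t ht
        exact ((hρ.2 t ht).1 e).2.le
  · obtain ⟨σ, hσ⟩ := exists_isSolution_exitTime hf ρ₀
    obtain ⟨S, hS, _, hlim⟩ := hσ.exists_cut_of_exitTime_ne_top h₀ htop
    refine ⟨S, hS, fun ρ hρ e he => (hlim e he).congr' ?_⟩
    filter_upwards [eventually_endFilter_mem (exitTime_pos f h₀)] with t ht
    rw [hσ.eqOn hf hρ ⟨ht, ht⟩]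

end RoutingPolicy

end FlowNetwork

theorem theorem1 {V E : Type*} [Fintype V] [DecidableEq V] [Fintype E] [DecidableEq E]
    (N : FlowNetwork V E) (hN : N.Connected) (f : N.RoutingPolicy) (hf : f.IsMonotone) :
    -- well-posedness: there is exactly one solution, defined up to the exit time
    (∀ ρ₀ ∈ N.states, 0 < f.exitTime ρ₀ ∧
      ∃ ρ, f.IsSolution ρ₀ (f.exitTime ρ₀) ρ ∧
        ∀ T ρ', f.IsSolution ρ₀ T ρ' → Set.EqOn ρ' ρ (FlowNetwork.timeInterval T)) ∧
    -- (i)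
    (N.maxExcess < 0 →
      (∀ ρ₀ ∈ N.states, f.exitTime ρ₀ = ⊤) ∧
      (f.IsStronglyMonotone →
        ∃ ρeq, f.IsEquilibrium ρeq ∧
          ∀ ρ₀ ∈ N.states, ∀ ρ, f.IsSolution ρ₀ (f.exitTime ρ₀) ρ →
            Tendsto ρ atTop (𝓝 ρeq))) ∧
    -- (ii)
    (0 < N.maxExcess ∨ (N.maxExcess = 0 ∧ f.IsStronglyMonotone) →
      ∀ ρ₀ ∈ N.states, ∃ S ∈ N.cuts,
        ∀ ρ, f.IsSolution ρ₀ (f.exitTime ρ₀) ρ →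
          ∀ e, N.tail e ∈ S →
            Tendsto (fun t : ℝ≥0∞ => ENNReal.ofReal (ρ t.toReal e))
              (𝓝[<] f.exitTime ρ₀) (𝓝 (N.buffer e))) := by
  refine ⟨fun ρ₀ h₀ => ⟨FlowNetwork.RoutingPolicy.exitTime_pos f h₀, ?_⟩, fun hneg =>
    ⟨fun ρ₀ h₀ => FlowNetwork.RoutingPolicy.exitTime_eq_top_of_maxExcess_neg hf hneg h₀,
      fun hs => hs.exists_equilibrium_of_maxExcess_neg hN hneg⟩, fun h ρ₀ h₀ => ?_⟩
  · obtain ⟨ρ, hρ⟩ := FlowNetwork.RoutingPolicy.exists_isSolution_exitTime hf ρ₀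
    refine ⟨ρ, hρ, fun T ρ' hρ' t ht => hρ'.eqOn hf hρ ⟨ht, ht.1, ht.2.trans_le ?_⟩⟩
    exact le_sSup ⟨ρ', hρ'⟩
  · obtain ⟨S, hS, hlim⟩ :=
      FlowNetwork.RoutingPolicy.exists_congested_cut_of_overload hN hf h h₀
    exact ⟨S, hS, fun ρ hρ e he => tendsto_map'_iff.1 (hlim ρ hρ e he)⟩
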